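/- Let $0<k<1$, $k'=\sqrt{1-k^2}$, $K=K(k)=\int_0^{\pi/2}\frac{du}{\sqrt{1-k^2\sin^2u}}$, $K'=K(k')$, $\tau=iK'/K$, and write $\theta_3(v)=\sum_{n\in\mathbb Z}e^{i\pi(n^2\tau+2nv)}$, $\theta_4(v)=\theta_3(v+\tfrac12)$, $\theta_2(v)=\sum_{n\in\mathbb Z}e^{i\pi((n+1/2)^2\tau+(2n+1)v)}$, $\theta_1(v)=\theta_2(v-\tfrac12)$ for the Jacobi theta functions. Let $P_s=(\zeta_s,\eta_s)$, $s=1,\dots,4$, be points of the affine curve $$0=\eta^2+\tfrac{K^2}{4}\left(\zeta^4+2(k^2-k'^2)\zeta^2+1\right),$$ and let $\alpha_s=\frac14\int_{\infty_1}^{P_s}\frac{d\zeta}{\eta}$ be their Abel images, taken along arbitrary paths on the curve, where $\infty_1$ is the point over $\zeta=\infty$ at which $\eta/\zeta^2=-iK/2$. For $z\in\mathbb C$ put $a_s=-\theta_3(\alpha_s)\theta_2(\alpha_s-z/2)$, $b_s=\theta_1(\alpha_s)\theta_4(\alpha_s-z/2)$, and let $\Psi$ be the $4\times4$ matrix whose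 $s$-th column is $$\begin{pmatrix}1\\ i\zeta_s\end{pmatrix}\otimes\begin{pmatrix}a_s\\ b_s\end{pmatrix}=(a_s,\;b_s,\;i\zeta_sa_s,\;i\zeta_sb_s)^T .$$ Then $\theta_1(\alpha_s)\ne0\ne\theta_3(\alpha_s)$ for all $s$, and for every choice of distinct $i,j,k,l\in\{1,2,3,4\}$ the $i$-th column of $\operatorname{Adj}(\Psi)^T$ (the transpose of the classical adjoint) is $$\begin{pmatrix} i\zeta_j\,\frac{\theta_2(z/2)\,\theta_2(\sum_{s\ne i}\alpha_s-z/2)}{\prod_{s\ne i}\theta_3(\alpha_s)}-\frac{\theta_2(0)\theta_4(0)\theta_3(\alpha_j+\alpha_k)\theta_3(\alpha_j+\alpha_l)\theta_4(\alpha_j-z/2)\theta_4(\alpha_k+\alpha_l-z/2)}{\theta_3(\alpha_j)\prod_{s\ne i}\theta_1(\alpha_s)\theta_3(\alpha_s)}\\[2ex] i\zeta_j\,\frac{\theta_2(z/2)\,\theta_4(\sum_{s\ne i}\alpha_s-z/2)}{\prod_{s\ne i}\theta_1(\alpha_s)}-\frac{\theta_2(0)\theta_4(0)\theta_3(\alpha_j+\alpha_k)\theta_3(\alpha_j+\alpha_l)\theta_2(\alpha_j-z/2)\theta_4(\alpha_k+\alpha_l-z/2)}{\theta_1(\alpha_j)\prod_{s\ne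 i}\theta_1(\alpha_s)\theta_3(\alpha_s)}\\[2ex] -\frac{\theta_2(z/2)\,\theta_2(\sum_{s\ne i}\alpha_s-z/2)}{\prod_{s\ne i}\theta_3(\alpha_s)}\\[2ex] -\frac{\theta_2(z/2)\,\theta_4(\sum_{s\ne i}\alpha_s-z/2)}{\prod_{s\ne i}\theta_1(\alpha_s)} \end{pmatrix}d_i,$$ where, with the totally antisymmetric symbol normalized by $\epsilon_{1234}=1$, $$d_i=-\epsilon_{ijkl}\,\theta_2(0)\theta_3(0)\theta_4(0)\,\theta_1(\alpha_j-\alpha_k)\theta_1(\alpha_j-\alpha_l)\theta_1(\alpha_k-\alpha_l)\,\theta_2(z/2).$$ Here $i$ in front of $\zeta$ and in exponents is the imaginary unit, and an index elsewhere; $k$ as an index is unrelated to the modulus $k$. -/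

import Mathlib

namespace MonopoleCurve

open Filter Topology

noncomputable section

/-- Jacobi's `θ₃(v|τ) = ∑ₙ exp (iπ (n² τ + 2 n v))`. -/
def theta3 (τ v : ℂ) : ℂ := jacobiTheta₂ v τ

/-- Jacobi's `θ₄(v|τ) = ∑ₙ (-1)ⁿ exp (iπ (n² τ + 2 n v)) = θ₃(v + 1/2)`. -/
def theta4 (τ v : ℂ) : ℂ := jacobiTheta₂ (v + 1 / 2) τ

/-- Jacobi's `θ₂(v|τ) = ∑ₙ exp (iπ ((n + 1/2)² τ + (2 n + 1) v))`. -/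
def theta2 (τ v : ℂ) : ℂ :=
  Complex.exp (Real.pi * Complex.I * (τ / 4 + v)) * jacobiTheta₂ (v + τ / 2) τ

/-- Jacobi's `θ₁(v|τ) = θ₂(v - 1/2|τ) = 2 ∑_{n ≥ 0} (-1)ⁿ q^{(n+1/2)²} sin ((2n+1) π v)`,
where `q = exp (iπτ)`. -/
def theta1 (τ v : ℂ) : ℂ := theta2 τ (v - 1 / 2)

/-- The complete elliptic integral of the first kind with modulus `k`. -/
def ellipticK (k : ℝ) : ℝ :=
  ∫ u in (0 : ℝ)..(Real.pi / 2), 1 / √(1 - k ^ 2 * Real.sin u ^ 2)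

/-- The complementary modulus `k'`. -/
def coModulus (k : ℝ) : ℝ := √(1 - k ^ 2)

/-- The period `τ = i K' / K`, with `K' = K(k')`. -/
def period (k : ℝ) : ℂ :=
  Complex.I * (ellipticK (coModulus k) : ℂ) / (ellipticK k : ℂ)

/-- The affine spectral curve `0 = η² + (K²/4) (ζ⁴ + 2 (k² - k'²) ζ² + 1)`. -/
def OnCurve (k : ℝ) (ζ η : ℂ) : Prop :=
  0 = η ^ 2 + (ellipticK k : ℂ) ^ 2 / 4 *
    (ζ ^ 4 + 2 * ((k : ℂ) ^ 2 - (coModulus k : ℂ) ^ 2) * ζ ^ 2 + 1)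

/-- `t ↦ (ζ t, η t)`, `0 < t ≤ 1`, is a continuously differentiable path on the curve that starts
(as `t → 0`) at the point `∞₁`, the point over `ζ = ∞` at which `η / ζ² = - i K / 2`, ends at
`(ζ₀, η₀)`, and meets no branch point `η = 0` before its end. -/
structure IsPathFromInfinity (k : ℝ) (ζ η : ℝ → ℂ) (ζ₀ η₀ : ℂ) : Prop where
  contDiffOn_zeta : ContDiffOn ℝ 1 ζ (Set.Ioc 0 1)
  contDiffOn_eta : ContDiffOn ℝ 1 η (Set.Ioc 0 1)
  onCurve : ∀ t ∈ Set.Ioc (0 : ℝ) 1, OnCurve k (ζ t) (η t)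
  eta_ne_zero : ∀ t ∈ Set.Ioo (0 : ℝ) 1, η t ≠ 0
  tendsto_zeta : Tendsto (fun t => ‖ζ t‖) (𝓝[>] 0) atTop
  tendsto_sheet :
    Tendsto (fun t => η t / ζ t ^ 2) (𝓝[>] 0) (𝓝 (-(Complex.I * (ellipticK k : ℂ) / 2)))
  zeta_one : ζ 1 = ζ₀
  eta_one : η 1 = η₀

/-- `α` is a value of the Abel map `∫_{∞₁}^{P} dζ / (4 η)` at `P = (ζ₀, η₀)`, along some path. -/
def IsAbelImage (k : ℝ) (ζ₀ η₀ α : ℂ) : Prop :=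
  ∃ ζ η : ℝ → ℂ, IsPathFromInfinity k ζ η ζ₀ η₀ ∧
    Tendsto (fun ε : ℝ => ∫ t in ε..1, deriv ζ t / (4 * η t)) (𝓝[>] 0) (𝓝 α)

/-- `a = - θ₃(α) θ₂(α - z/2)`. -/
def aEntry (τ z α : ℂ) : ℂ := -(theta3 τ α * theta2 τ (α - z / 2))

/-- `b = θ₁(α) θ₄(α - z/2)`. -/
def bEntry (τ z α : ℂ) : ℂ := theta1 τ α * theta4 τ (α - z / 2)

/-- The matrix `Ψ` with columns `(1, i ζ_c) ⊗ (a_c, b_c)`. -/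
def Psi (τ z : ℂ) (ζ α : Fin 4 → ℂ) : Matrix (Fin 4) (Fin 4) ℂ :=
  Matrix.of ![
    fun c => aEntry τ z (α c),
    fun c => bEntry τ z (α c),
    fun c => Complex.I * ζ c * aEntry τ z (α c),
    fun c => Complex.I * ζ c * bEntry τ z (α c)]

/-- The totally antisymmetric symbol `ε_{ijkl}` on four indices, as the product of the signs of the
differences `y - x` over all pairs with `x` standing before `y`. -/
def leviCivita (i j k l : Fin 4) : ℤ :=
  Int.sign ((j.val : ℤ) - i.val) * Int.sign ((k.val : ℤ) - i.val) *
    Int.sign ((l.val : ℤ) - i.val) * Int.sign ((k.val : ℤ) - j.val) *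
    Int.sign ((l.val : ℤ) - j.val) * Int.sign ((l.val : ℤ) - k.val)

/-- The scalar factor `d_i` (with the choice of the remaining indices `j, k, l`). -/
def dFactor (τ z : ℂ) (α : Fin 4 → ℂ) (i j k l : Fin 4) : ℂ :=
  -(leviCivita i j k l : ℂ) * (theta2 τ 0 * theta3 τ 0 * theta4 τ 0) *
    (theta1 τ (α j - α k) * theta1 τ (α j - α l) * theta1 τ (α k - α l)) * theta2 τ (z / 2)

/-- The column vector that multiplies `d_i`. -/
def adjVector (τ z : ℂ) (ζ α : Fin 4 → ℂ) (i j k l : Fin 4) : Fin 4 → ℂ :=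
  ![Complex.I * ζ j *
        (theta2 τ (z / 2) * theta2 τ ((∑ s ∈ Finset.univ.erase i, α s) - z / 2) /
          ∏ s ∈ Finset.univ.erase i, theta3 τ (α s)) -
      theta2 τ 0 * theta4 τ 0 * theta3 τ (α j + α k) * theta3 τ (α j + α l) *
          theta4 τ (α j - z / 2) * theta4 τ (α k + α l - z / 2) /
        (theta3 τ (α j) * ∏ s ∈ Finset.univ.erase i, theta1 τ (α s) * theta3 τ (α s)),
    Complex.I * ζ j *
        (theta2 τ (z / 2) * theta4 τ ((∑ s ∈ Finset.univ.erase i, α s) - z / 2) /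
          ∏ s ∈ Finset.univ.erase i, theta1 τ (α s)) -
      theta2 τ 0 * theta4 τ 0 * theta3 τ (α j + α k) * theta3 τ (α j + α l) *
          theta2 τ (α j - z / 2) * theta4 τ (α k + α l - z / 2) /
        (theta1 τ (α j) * ∏ s ∈ Finset.univ.erase i, theta1 τ (α s) * theta3 τ (α s)),
    -(theta2 τ (z / 2) * theta2 τ ((∑ s ∈ Finset.univ.erase i, α s) - z / 2) /
        ∏ s ∈ Finset.univ.erase i, theta3 τ (α s)),
    -(theta2 τ (z / 2) * theta4 τ ((∑ s ∈ Finset.univ.erase i, α s) - z / 2) /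
        ∏ s ∈ Finset.univ.erase i, theta1 τ (α s))]

end

end MonopoleCurve

namespace MonopoleCurve

open Complex Filter Topology

/-! Put w = iζ. Everything rests on one analytic fact: w = θ₂(α)θ₄(α) / (θ₁(α)θ₃(α)) at each Abel
image (`theta_inversion`). Once it is known, the adjugate is a matter of theta identities.

Algebra. A product of two thetas of period τ is bilinear in thetas of period 2τ (`theta3_mul_theta3`
and its translates), which turns the Weierstrass relation `theta_three_term` into a polynomial
identity. Its translates and specializations give the 2 × 2 minors of the rows a, b
(`theta_three_term_mixed`) and the differences of the w's (`theta_addition`). In a 3 × 3 minor of Ψ,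
w_j times a row is split off; a two-term combination remains, which a further three-term relation
collapses into a product (`minor_a_b_wb`, `minor_a_b_wa`). Column permutations reduce all index
choices to one (`adjugate_submatrix_perm`).

Analysis. Differentiating the addition theorem shows that the theta quotient satisfies the
differential equation of the curve, with coefficients in theta constants (`thetaWronskian_sq`).
These are matched with k, K, K' by starting from τ = it instead of k: for the modulus θ₂(0)²/θ₃(0)²,
the substitution u = 2 arctan(θ₁θ₃/(θ₂θ₄)) evaluates K (`ellipticK_thetaModulus`), the imaginary
transformation gives K' = tK (`thetaK_modular`), and an intermediate value argument reaches every k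
(`exists_thetaModulus_eq`). Inversion is then uniqueness for a differential equation, continued
along the path from ∞₁, where the prescribed sheet fixes the sign of the square root. Since θ₂θ₄ and
θ₁θ₃ have no common zero and ζ is finite, θ₁(α)θ₃(α) cannot vanish. -/

/-! ### Products of two theta functions and the doubled period -/

/-- Pairs of integers split by the parity of their sum: `(p + q, p - q)` and `(p + q + 1, p - q)`. -/
def parityPairs : (ℤ × ℤ) ⊕ (ℤ × ℤ) → ℤ × ℤ :=
  Sum.elim (fun p => (p.1 + p.2, p.1 - p.2)) (fun p => (p.1 + p.2 + 1, p.1 - p.2))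

lemma parityPairs_bijective : Function.Bijective parityPairs := by
  constructor
  · rintro (⟨a, b⟩ | ⟨a, b⟩) (⟨c, d⟩ | ⟨c, d⟩) h <;>
      simp only [parityPairs, Sum.elim_inl, Sum.elim_inr, Prod.mk.injEq, Sum.inl.injEq,
        Sum.inr.injEq, reduceCtorEq] at h ⊢ <;> omega
  · rintro ⟨m, n⟩
    rcases Int.even_or_odd' (m + n) with ⟨p, hp | hp⟩
    · exact ⟨Sum.inl (p, m - p), by simp only [parityPairs, Sum.elim_inl, Prod.mk.injEq]; omega⟩
    · exact ⟨Sum.inr (p, m - 1 - p), by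
        simp only [parityPairs, Sum.elim_inr, Prod.mk.injEq]; omega⟩

lemma hasSum_mul_prod {f g : ℤ → ℂ} {a b : ℂ} (hf : HasSum f a) (hg : HasSum g b) :
    HasSum (fun p : ℤ × ℤ => f p.1 * g p.2) (a * b) := by
  have hfg := summable_mul_of_summable_norm (f := f) (g := g) hf.summable.norm hg.summable.norm
  exact hf.mul hg hfg

lemma hasSum_jacobiTheta₂_mul (u v : ℂ) {σ : ℂ} (hσ : 0 < σ.im) :
    HasSum (fun p : ℤ × ℤ => jacobiTheta₂_term p.1 u σ * jacobiTheta₂_term p.2 v σ)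
      (jacobiTheta₂ u σ * jacobiTheta₂ v σ) := by
  have h := hasSum_mul_prod (f := fun n => jacobiTheta₂_term n u σ)
    (g := fun n => jacobiTheta₂_term n v σ) (hasSum_jacobiTheta₂_term u hσ)
    (hasSum_jacobiTheta₂_term v hσ)
  simpa only using h

/-- Reindex the double series by m = p + q, n = p - q: then m² + n² = 2(p² + q²) and mx + ny = p(x +
y) + q(x - y), so the sum factors. Pairs with m + n even have integral p, q and give the θ₃ product;
pairs with m + n odd have half-integral p, q and give the θ₂ product. -/
lemma theta3_mul_theta3 (x y : ℂ) {τ : ℂ} (hτ : 0 < τ.im) :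
    theta3 τ x * theta3 τ y =
      theta3 (2 * τ) (x + y) * theta3 (2 * τ) (x - y) +
        theta2 (2 * τ) (x + y) * theta2 (2 * τ) (x - y) := by
  have h2τ : 0 < (2 * τ).im := by simpa using hτ
  have hE := hasSum_jacobiTheta₂_mul (x + y) (x - y) h2τ
  have hO := (hasSum_jacobiTheta₂_mul (x + y + 2 * τ / 2) (x - y + 2 * τ / 2) h2τ).mul_left
    (cexp (Real.pi * I * (2 * τ / 4 + (x + y))) * cexp (Real.pi * I * (2 * τ / 4 + (x - y))))
  have hsum : HasSum (fun s => jacobiTheta₂_term (parityPairs s).1 x τ *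
      jacobiTheta₂_term (parityPairs s).2 y τ)
      (jacobiTheta₂ (x + y) (2 * τ) * jacobiTheta₂ (x - y) (2 * τ) +
        cexp (Real.pi * I * (2 * τ / 4 + (x + y))) * cexp (Real.pi * I * (2 * τ / 4 + (x - y))) *
        (jacobiTheta₂ (x + y + 2 * τ / 2) (2 * τ) *
          jacobiTheta₂ (x - y + 2 * τ / 2) (2 * τ))) := by
    refine HasSum.sum ?_ ?_
    · refine hE.congr_fun fun p => ?_
      simp only [parityPairs, Function.comp_apply, Sum.elim_inl, jacobiTheta₂_term,
        ← Complex.exp_add]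
      congr 1
      push_cast
      ring
    · refine hO.congr_fun fun p => ?_
      simp only [parityPairs, Function.comp_apply, Sum.elim_inr, jacobiTheta₂_term,
        ← Complex.exp_add]
      congr 1
      push_cast
      ring
  have h := (hasSum_jacobiTheta₂_mul x y hτ)
  have h' := ((Equiv.ofBijective _ parityPairs_bijective).hasSum_iff
    (f := fun p : ℤ × ℤ => jacobiTheta₂_term p.1 x τ * jacobiTheta₂_term p.2 y τ)).2 h
  have := h'.unique hsum
  simp only [theta3, theta2]
  rw [this]
  ring

/-! ### Parity and half-period translations -/

lemma theta3_neg (τ v : ℂ) : theta3 τ (-v) = theta3 τ v := jacobiTheta₂_neg_left v τ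

lemma theta3_add_one (τ v : ℂ) : theta3 τ (v + 1) = theta3 τ v := jacobiTheta₂_add_left v τ

lemma theta3_add_half (τ v : ℂ) : theta3 τ (v + 1 / 2) = theta4 τ v := rfl

lemma theta4_add_half (τ v : ℂ) : theta4 τ (v + 1 / 2) = theta3 τ v := by
  rw [theta4, show v + 1 / 2 + 1 / 2 = v + 1 by ring, jacobiTheta₂_add_left, theta3]

lemma theta4_neg (τ v : ℂ) : theta4 τ (-v) = theta4 τ v := by
  rw [theta4, theta4, ← jacobiTheta₂_neg_left, ← jacobiTheta₂_add_left]
  congr 1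
  ring

lemma exp_pi_mul_I_mul_half : cexp (Real.pi * I * (1 / 2)) = I := by
  rw [show (Real.pi : ℂ) * I * (1 / 2) = Real.pi / 2 * I by ring, exp_pi_div_two_mul_I]

lemma theta2_add_one (τ v : ℂ) : theta2 τ (v + 1) = -theta2 τ v := by
  rw [theta2, theta2, show v + 1 + τ / 2 = v + τ / 2 + 1 by ring, jacobiTheta₂_add_left,
    show (Real.pi : ℂ) * I * (τ / 4 + (v + 1)) = Real.pi * I * (τ / 4 + v) + Real.pi * I by ring,
    Complex.exp_add, exp_pi_mul_I]
  ring

lemma theta2_sub_half (τ v : ℂ) : theta2 τ (v - 1 / 2) = theta1 τ v := rfl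

lemma theta1_add_half (τ v : ℂ) : theta1 τ (v + 1 / 2) = theta2 τ v := by
  rw [theta1, add_sub_cancel_right]

lemma theta2_add_half (τ v : ℂ) : theta2 τ (v + 1 / 2) = -theta1 τ v := by
  rw [theta1, ← theta2_add_one]
  congr 1
  ring

lemma theta2_neg (τ v : ℂ) : theta2 τ (-v) = theta2 τ v := by
  have h : jacobiTheta₂ (-v + τ / 2) τ = cexp (Real.pi * I * (2 * v)) *
      jacobiTheta₂ (v + τ / 2) τ := by
    rw [← jacobiTheta₂_neg_left (v + τ / 2), show -v + τ / 2 = -(v + τ / 2) + τ by ring,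
      jacobiTheta₂_add_left']
    congr 2
    ring
  rw [theta2, theta2, h, ← mul_assoc, ← Complex.exp_add]
  congr 2
  ring

lemma theta1_neg (τ v : ℂ) : theta1 τ (-v) = -theta1 τ v := by
  rw [theta1, ← theta2_neg, ← theta2_add_half]
  congr 1
  ring

lemma theta1_zero (τ : ℂ) : theta1 τ 0 = 0 := by
  have h := theta1_neg τ 0
  rw [neg_zero] at h
  linear_combination h / 2

/-- The exponential factor picked up by the theta functions under translation by `τ / 2`. -/
noncomputable def halfShift (τ v : ℂ) : ℂ := cexp (-(Real.pi * I * (τ / 4 + v)))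

lemma halfShift_ne_zero (τ v : ℂ) : halfShift τ v ≠ 0 := Complex.exp_ne_zero _

lemma theta3_add_half_period (τ v : ℂ) : theta3 τ (v + τ / 2) = halfShift τ v * theta2 τ v := by
  rw [theta3, theta2, halfShift, ← mul_assoc, ← Complex.exp_add, neg_add_cancel, Complex.exp_zero,
    one_mul]

lemma theta2_add_half_period (τ v : ℂ) : theta2 τ (v + τ / 2) = halfShift τ v * theta3 τ v := by
  rw [theta3, theta2, halfShift, show v + τ / 2 + τ / 2 = v + τ by ring, jacobiTheta₂_add_left',
    ← mul_assoc, ← Complex.exp_add]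
  congr 2
  ring

lemma halfShift_add_half (τ v : ℂ) : halfShift τ (v + 1 / 2) = -I * halfShift τ v := by
  have h : -I = cexp (-(Real.pi * I * (1 / 2))) := by
    rw [Complex.exp_neg, exp_pi_mul_I_mul_half, inv_I]
  rw [halfShift, halfShift, h, ← Complex.exp_add]
  congr 1
  ring

lemma theta4_add_half_period (τ v : ℂ) :
    theta4 τ (v + τ / 2) = I * halfShift τ v * theta1 τ v := by
  rw [← theta3_add_half, add_right_comm, theta3_add_half_period, theta2_add_half,
    halfShift_add_half]
  ring

lemma theta1_add_half_period (τ v : ℂ) :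
    theta1 τ (v + τ / 2) = I * halfShift τ v * theta4 τ v := by
  have h : halfShift τ (v - 1 / 2) = I * halfShift τ v := by
    have := halfShift_add_half τ (v - 1 / 2)
    rw [sub_add_cancel] at this
    rw [this]
    linear_combination halfShift τ (v - 1 / 2) * I_mul_I
  rw [← theta2_sub_half, show v + τ / 2 - 1 / 2 = v - 1 / 2 + τ / 2 by ring,
    theta2_add_half_period, h]
  congr 1
  rw [← theta4_add_half, sub_add_cancel]

section ProductFormulas

variable (x y : ℂ) {τ : ℂ} (hτ : 0 < τ.im)
include hτ

lemma theta4_mul_theta4 :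
    theta4 τ x * theta4 τ y =
      theta3 (2 * τ) (x + y) * theta3 (2 * τ) (x - y) -
        theta2 (2 * τ) (x + y) * theta2 (2 * τ) (x - y) := by
  rw [← theta3_add_half, ← theta3_add_half, theta3_mul_theta3 _ _ hτ,
    show x + 1 / 2 + (y + 1 / 2) = x + y + 1 by ring,
    show x + 1 / 2 - (y + 1 / 2) = x - y by ring, theta3_add_one, theta2_add_one]
  ring

/-- Translating both arguments by τ/2 moves x + y by half of the doubled period and fixes x - y. The
two exponential factors multiply to the one belonging to 2τ, so they cancel. -/
lemma theta2_mul_theta2 :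
    theta2 τ x * theta2 τ y =
      theta2 (2 * τ) (x + y) * theta3 (2 * τ) (x - y) +
        theta3 (2 * τ) (x + y) * theta2 (2 * τ) (x - y) := by
  have h := theta3_mul_theta3 (x + τ / 2) (y + τ / 2) hτ
  rw [show x + τ / 2 + (y + τ / 2) = x + y + 2 * τ / 2 by ring,
    show x + τ / 2 - (y + τ / 2) = x - y by ring, theta3_add_half_period, theta3_add_half_period,
    theta3_add_half_period, theta2_add_half_period] at h
  have he : halfShift (2 * τ) (x + y) = halfShift τ x * halfShift τ y := by
    rw [halfShift, halfShift, halfShift, ← Complex.exp_add]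
    congr 1
    ring
  have hne := mul_ne_zero (halfShift_ne_zero τ x) (halfShift_ne_zero τ y)
  rw [he] at h
  apply mul_left_cancel₀ hne
  linear_combination h

lemma theta1_mul_theta1 :
    theta1 τ x * theta1 τ y =
      theta3 (2 * τ) (x + y) * theta2 (2 * τ) (x - y) -
        theta2 (2 * τ) (x + y) * theta3 (2 * τ) (x - y) := by
  have h := theta2_mul_theta2 (x + 1 / 2) (y + 1 / 2) hτ
  rw [show x + 1 / 2 + (y + 1 / 2) = x + y + 1 by ring,
    show x + 1 / 2 - (y + 1 / 2) = x - y by ring, theta3_add_one, theta2_add_one,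
    theta2_add_half, theta2_add_half] at h
  linear_combination h

end ProductFormulas

/-! ### Three-term relations and the addition theorem -/

section Weierstrass

variable {τ : ℂ} (hτ : 0 < τ.im) (j k l y : ℂ)
include hτ

/-- A three-term relation between products of four theta functions. -/
lemma theta_three_term :
    theta3 τ k * theta3 τ (j + l) * (theta4 τ (l - y) * theta4 τ (j + k - y)) -
      theta3 τ l * theta3 τ (j + k) * (theta4 τ (k - y) * theta4 τ (j + l - y)) =
    theta1 τ j * theta1 τ (k - l) * (theta2 τ y * theta2 τ (j + k + l - y)) := by
  -- The pairing is chosen so that, up to sign, only four arguments occur at period 2τ: j+k+l,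
  -- j+k+l-2y, l-j-k and k-j-l.
  rw [theta3_mul_theta3 _ _ hτ, theta3_mul_theta3 _ _ hτ, theta4_mul_theta4 _ _ hτ,
    theta4_mul_theta4 _ _ hτ, theta1_mul_theta1 _ _ hτ, theta2_mul_theta2 _ _ hτ,
    show k + (j + l) = j + k + l by ring, show l + (j + k) = j + k + l by ring,
    show l - y + (j + k - y) = j + k + l - 2 * y by ring,
    show k - y + (j + l - y) = j + k + l - 2 * y by ring,
    show l - y - (j + k - y) = l - j - k by ring,
    show k - y - (j + l - y) = k - j - l by ring,
    show k - (j + l) = k - j - l by ring, show l - (j + k) = l - j - k by ring,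
    show j + (k - l) = -(l - j - k) by ring, show j - (k - l) = -(k - j - l) by ring,
    show y + (j + k + l - y) = j + k + l by ring,
    show y - (j + k + l - y) = -(j + k + l - 2 * y) by ring]
  simp only [theta3_neg, theta2_neg]
  ring

/-- This is `theta_three_term` with j moved by 1/2 + τ/2; all three terms acquire the same
exponential factor, which is cancelled. -/
lemma theta_three_term_shifted :
    theta3 τ k * theta1 τ (j + l) * (theta4 τ (l - y) * theta2 τ (j + k - y)) -
      theta3 τ l * theta1 τ (j + k) * (theta4 τ (k - y) * theta2 τ (j + l - y)) =
    -(theta3 τ j * theta1 τ (k - l) * (theta2 τ y * theta4 τ (j + k + l - y))) := by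
  have h3 (v : ℂ) : theta3 τ (v + 1 / 2 + τ / 2) = I * halfShift τ v * theta1 τ v := by
    rw [theta3_add_half_period, theta2_add_half, halfShift_add_half]
    ring
  have h4 (v : ℂ) : theta4 τ (v + 1 / 2 + τ / 2) = halfShift τ v * theta2 τ v := by
    rw [theta4_add_half_period, theta1_add_half, halfShift_add_half]
    linear_combination -halfShift τ v * theta2 τ v * I_mul_I
  have h1 (v : ℂ) : theta1 τ (v + 1 / 2 + τ / 2) = halfShift τ v * theta3 τ v := by
    rw [theta1_add_half_period, theta4_add_half, halfShift_add_half]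
    linear_combination -halfShift τ v * theta3 τ v * I_mul_I
  have h2 (v : ℂ) : theta2 τ (v + 1 / 2 + τ / 2) = -I * halfShift τ v * theta4 τ v := by
    rw [theta2_add_half_period, theta3_add_half, halfShift_add_half]
  have h := theta_three_term hτ (j + 1 / 2 + τ / 2) k l y
  rw [show j + 1 / 2 + τ / 2 + l = j + l + 1 / 2 + τ / 2 by ring,
    show j + 1 / 2 + τ / 2 + k - y = j + k - y + 1 / 2 + τ / 2 by ring,
    show j + 1 / 2 + τ / 2 + k = j + k + 1 / 2 + τ / 2 by ring,
    show j + l + 1 / 2 + τ / 2 - y = j + l - y + 1 / 2 + τ / 2 by ring,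
    show j + k + 1 / 2 + τ / 2 + l - y = j + k + l - y + 1 / 2 + τ / 2 by ring,
    h3, h3, h4, h4, h1, h2] at h
  have e1 : halfShift τ (j + l) * halfShift τ (j + k - y) =
      halfShift τ j * halfShift τ (j + k + l - y) := by
    simp only [halfShift, ← Complex.exp_add]
    congr 1
    ring
  have e2 : halfShift τ (j + k) * halfShift τ (j + l - y) =
      halfShift τ j * halfShift τ (j + k + l - y) := by
    simp only [halfShift, ← Complex.exp_add]
    congr 1
    ring
  have hne := mul_ne_zero I_ne_zero
    (mul_ne_zero (halfShift_ne_zero τ j) (halfShift_ne_zero τ (j + k + l - y)))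
  apply mul_left_cancel₀ hne
  linear_combination h - I * theta3 τ k * theta1 τ (j + l) * (theta4 τ (l - y) *
    theta2 τ (j + k - y)) * e1 + I * theta3 τ l * theta1 τ (j + k) * (theta4 τ (k - y) *
    theta2 τ (j + l - y)) * e2

lemma theta_three_term_mixed :
    theta1 τ k * theta3 τ (j + l) * (theta2 τ (l - y) * theta4 τ (j + k - y)) -
      theta1 τ l * theta3 τ (j + k) * (theta2 τ (k - y) * theta4 τ (j + l - y)) =
    theta3 τ j * theta1 τ (k - l) * (theta2 τ y * theta4 τ (j + k + l - y)) := by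
  have h := theta_three_term_shifted hτ (-j) (j + l) (j + k) y
  rw [show -j + (j + k) = k by ring, show -j + (j + l) = l by ring, theta3_neg,
    show j + l - (j + k) = -(k - l) by ring, theta1_neg,
    show l + (j + k) = j + k + l by ring] at h
  linear_combination h

/-- The addition theorem for the quotient `θ₁ θ₃ / (θ₂ θ₄)`. -/
lemma theta_addition :
    theta1 τ j * theta3 τ j * (theta2 τ k * theta4 τ k) -
      theta2 τ j * theta4 τ j * (theta1 τ k * theta3 τ k) =
    theta2 τ 0 * theta4 τ 0 * (theta1 τ (j - k) * theta3 τ (j + k)) := by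
  -- The three arguments sum to zero and y = 0, which produces the constants θ₂(0)θ₄(0).
  have h := theta_three_term_shifted hτ (-(j + k)) j k 0
  rw [show -(j + k) + j + k = 0 by ring, show -(j + k) + k = -j by ring,
    show -(j + k) + j = -k by ring, sub_zero, sub_zero,
    sub_zero, sub_zero, sub_zero, theta3_neg, theta1_neg, theta1_neg, theta2_neg,
    theta2_neg] at h
  linear_combination -h

end Weierstrass

/-! ### Cofactors of Ψ -/

lemma sign_eq_leviCivita (σ : Equiv.Perm (Fin 4)) :
    (Equiv.Perm.sign σ : ℤ) = leviCivita (σ 0) (σ 1) (σ 2) (σ 3) := by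
  revert σ
  decide

/-- Both entries are determinants with row r replaced by a unit vector, and the two matrices differ
by a permutation of columns. This reduces every ordering of the indices to 0, 1, 2, 3. -/
lemma adjugate_submatrix_perm {n R : Type*} [Fintype n] [DecidableEq n] [CommRing R]
    (A : Matrix n n R) (σ : Equiv.Perm n) (i r : n) :
    A.adjugate (σ i) r = (Equiv.Perm.sign σ : ℤ) * (A.submatrix id σ).adjugate i r := by
  have h : (A.submatrix id σ).updateRow r (Pi.single i 1) =
      (A.updateRow r (Pi.single (σ i) 1)).submatrix id σ := by
    ext p q
    by_cases hp : p = r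
    · subst hp
      by_cases hq : q = i
      · subst hq
        simp
      · simp [hq]
    · simp [Matrix.updateRow_ne hp]
  have hs : ((Equiv.Perm.sign σ : ℤ) : R) * ((Equiv.Perm.sign σ : ℤ) : R) = 1 := by
    rw [← Int.cast_mul, ← Units.val_mul, Int.units_mul_self]
    simp
  rw [Matrix.adjugate_apply, Matrix.adjugate_apply, h, Matrix.det_permute', ← mul_assoc, hs, one_mul]

section Minors

/-! The cofactors of a `4 × 4` matrix with columns `(a, b, w a, w b)`, where `a = -(C p)` and
`b = A r`, along its first column. -/

variable {F : Type*} [Field F] {Aj Ak Al Cj Ck Cl pj pk pl rj rk rl wj wk wl : F}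
  {T e c Sjk Sjl Skl Qjk Qjl Rjk Rjl Rkl G H : F}

/-- Dictionary: A = θ₁(α), C = θ₃(α), p = θ₂(α - z/2), r = θ₄(α - z/2); S is θ₁ of a difference, Q
is θ₃ of a sum, R is θ₄ of a sum less z/2; T = θ₂(0)θ₄(0), c = θ₃(0), e = θ₂(z/2). Subtracting w_j
times row b from row wb clears its j-th entry. The remaining two terms share S_jk S_jl, and the last
hypothesis, a three-term relation, supplies S_kl. -/
lemma minor_a_b_wb (hAj : Aj ≠ 0) (hAk : Ak ≠ 0) (hAl : Al ≠ 0) (hCj : Cj ≠ 0) (hCk : Ck ≠ 0)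
    (hCl : Cl ≠ 0)
    (hwl : (wl - wj) * (Aj * Cj * (Al * Cl)) = T * (Sjl * Qjl))
    (hwk : (wk - wj) * (Aj * Cj * (Ak * Ck)) = T * (Sjk * Qjk))
    (hjk : Aj * Ck * (pk * rj) - Ak * Cj * (pj * rk) = c * Sjk * (e * Rjk))
    (hjl : Aj * Cl * (pl * rj) - Al * Cj * (pj * rl) = c * Sjl * (e * Rjl))
    (hG : Ck * Qjl * (rl * Rjk) - Cl * Qjk * (rk * Rjl) = Aj * Skl * (e * G)) :
    (wl - wj) * (Al * rl) * (Aj * Ck * (pk * rj) - Ak * Cj * (pj * rk)) -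
      (wk - wj) * (Ak * rk) * (Aj * Cl * (pl * rj) - Al * Cj * (pj * rl)) =
    T * c * (Sjk * Sjl * Skl) * e * (e * G / (Cj * (Ck * Cl))) := by
  rw [← mul_div_assoc, eq_div_iff (by positivity)]
  apply mul_left_cancel₀ (mul_ne_zero hAj (mul_ne_zero hAk hAl))
  linear_combination (Ak * Ck * Al * rl * (Aj * Ck * (pk * rj) - Ak * Cj * (pj * rk))) * hwl +
    (T * Sjl * Qjl * Ak * Ck * Al * rl) * hjk -
    (Al * Cl * Ak * rk * (Aj * Cl * (pl * rj) - Al * Cj * (pj * rl))) * hwk -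
    (T * Sjk * Qjk * Al * Cl * Ak * rk) * hjl + (T * c * e * Sjl * Sjk * Ak * Al) * hG

lemma minor_a_b_wa (hAj : Aj ≠ 0) (hAk : Ak ≠ 0) (hAl : Al ≠ 0) (hCj : Cj ≠ 0) (hCk : Ck ≠ 0)
    (hCl : Cl ≠ 0)
    (hwl : (wl - wj) * (Aj * Cj * (Al * Cl)) = T * (Sjl * Qjl))
    (hwk : (wk - wj) * (Aj * Cj * (Ak * Ck)) = T * (Sjk * Qjk))
    (hjk : Aj * Ck * (pk * rj) - Ak * Cj * (pj * rk) = c * Sjk * (e * Rjk))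
    (hjl : Aj * Cl * (pl * rj) - Al * Cj * (pj * rl) = c * Sjl * (e * Rjl))
    (hH : Ak * Qjl * (pl * Rjk) - Al * Qjk * (pk * Rjl) = Cj * Skl * (e * H)) :
    (wl - wj) * (Cl * pl) * (Aj * Ck * (pk * rj) - Ak * Cj * (pj * rk)) -
      (wk - wj) * (Ck * pk) * (Aj * Cl * (pl * rj) - Al * Cj * (pj * rl)) =
    T * c * (Sjk * Sjl * Skl) * e * (e * H / (Aj * (Ak * Al))) := by
  rw [← mul_div_assoc, eq_div_iff (by positivity)]
  apply mul_left_cancel₀ (mul_ne_zero hCj (mul_ne_zero hCk hCl))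
  linear_combination (Ak * Ck * Cl * pl * (Aj * Ck * (pk * rj) - Ak * Cj * (pj * rk))) * hwl +
    (T * Sjl * Qjl * Ak * Ck * Cl * pl) * hjk -
    (Al * Cl * Ck * pk * (Aj * Cl * (pl * rj) - Al * Cj * (pj * rl))) * hwk -
    (T * Sjk * Qjk * Al * Cl * Ck * pk) * hjl + (T * c * e * Sjl * Sjk * Ck * Cl) * hH

/-- With w - w_j in place of w, both w-rows vanish in column j, so a single 2 × 2 minor survives and
no further three-term relation is needed. -/
lemma diff_mul_diff_mul_minor (hAj : Aj ≠ 0) (hAk : Ak ≠ 0) (hAl : Al ≠ 0) (hCj : Cj ≠ 0)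
    (hCk : Ck ≠ 0) (hCl : Cl ≠ 0)
    (hwl : (wl - wj) * (Aj * Cj * (Al * Cl)) = T * (Sjl * Qjl))
    (hwk : (wk - wj) * (Aj * Cj * (Ak * Ck)) = T * (Sjk * Qjk))
    (hkl : Ak * Cl * (pl * rk) - Al * Ck * (pk * rl) = c * Skl * (e * Rkl)) :
    (wk - wj) * (wl - wj) * (Ak * Cl * (pl * rk) - Al * Ck * (pk * rl)) =
    T * c * (Sjk * Sjl * Skl) * e *
      (T * Qjk * Qjl * Rkl / (Aj * Cj * (Aj * Cj * (Ak * Ck * (Al * Cl))))) := by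
  rw [← mul_div_assoc, eq_div_iff (by positivity)]
  linear_combination ((wk - wj) * (wl - wj) * Aj * Cj * Aj * Cj * Ak * Ck * Al * Cl) * hkl +
    (c * Skl * e * Rkl * (wk - wj) * Aj * Cj * Ak * Ck) * hwl +
    (c * Skl * e * Rkl * T * Sjl * Qjl) * hwk

end Minors

lemma sum_univ_erase_zero (f : Fin 4 → ℂ) :
    ∑ s ∈ Finset.univ.erase 0, f s = f 1 + f 2 + f 3 := by
  rw [show (Finset.univ.erase 0 : Finset (Fin 4)) = {1, 2, 3} by decide]
  simp [add_assoc]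

lemma prod_univ_erase_zero (f : Fin 4 → ℂ) :
    ∏ s ∈ Finset.univ.erase 0, f s = f 1 * (f 2 * f 3) := by
  rw [show (Finset.univ.erase 0 : Finset (Fin 4)) = {1, 2, 3} by decide]
  simp

lemma adjVector_perm (τ z : ℂ) (ζ α : Fin 4 → ℂ) (σ : Equiv.Perm (Fin 4)) :
    adjVector τ z ζ α (σ 0) (σ 1) (σ 2) (σ 3) = adjVector τ z (ζ ∘ σ) (α ∘ σ) 0 1 2 3 := by
  have hset : (Finset.univ.erase (σ 0) : Finset (Fin 4)) =
      (Finset.univ.erase 0).map σ.toEmbedding := by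
    ext s
    simp
  simp only [adjVector, hset, Finset.sum_map, Finset.prod_map, Equiv.coe_toEmbedding,
    Function.comp_apply]

/-- The first column of the transposed adjugate of `Ψ`, when `i ζ = θ₂ θ₄ / (θ₁ θ₃)` at each
`α`. -/
lemma adjugate_Psi_zero {τ : ℂ} (hτ : 0 < τ.im) (z : ℂ) (ζ α : Fin 4 → ℂ)
    (hα : ∀ s, theta1 τ (α s) ≠ 0 ∧ theta3 τ (α s) ≠ 0)
    (hζ : ∀ s, I * ζ s * (theta1 τ (α s) * theta3 τ (α s)) = theta2 τ (α s) * theta4 τ (α s))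
    (r : Fin 4) :
    (Psi τ z ζ α).adjugate 0 r =
      -(theta2 τ 0 * theta3 τ 0 * theta4 τ 0) *
        (theta1 τ (α 1 - α 2) * theta1 τ (α 1 - α 3) * theta1 τ (α 2 - α 3)) * theta2 τ (z / 2) *
      adjVector τ z ζ α 0 1 2 3 r := by
  have hw (s t : Fin 4) := theta_addition hτ (α s) (α t)
  simp only [← hζ] at hw
  have hwl : (I * ζ 3 - I * ζ 1) * (theta1 τ (α 1) * theta3 τ (α 1) *
      (theta1 τ (α 3) * theta3 τ (α 3))) = theta2 τ 0 * theta4 τ 0 *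
      (theta1 τ (α 1 - α 3) * theta3 τ (α 1 + α 3)) := by
    rw [← hw 1 3]
    ring
  have hwk : (I * ζ 2 - I * ζ 1) * (theta1 τ (α 1) * theta3 τ (α 1) *
      (theta1 τ (α 2) * theta3 τ (α 2))) = theta2 τ 0 * theta4 τ 0 *
      (theta1 τ (α 1 - α 2) * theta3 τ (α 1 + α 2)) := by
    rw [← hw 1 2]
    ring
  -- With first argument 0 the relation evaluates the 2 × 2 minors of the rows a, b; this is the
  -- source of θ₃(0) in d_i.
  have hmix (k l : ℂ) := theta_three_term_mixed hτ 0 k l (z / 2)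
  simp only [zero_add] at hmix
  have hG := theta_three_term hτ (α 1) (α 2) (α 3) (z / 2)
  have hH := theta_three_term_mixed hτ (α 1) (α 2) (α 3) (z / 2)
  have h3 := minor_a_b_wb (hα 1).1 (hα 2).1 (hα 3).1 (hα 1).2 (hα 2).2 (hα 3).2 hwl hwk
    (hmix (α 1) (α 2)) (hmix (α 1) (α 3)) hG
  have h4 := minor_a_b_wa (hα 1).1 (hα 2).1 (hα 3).1 (hα 1).2 (hα 2).2 (hα 3).2 hwl hwk
    (hmix (α 1) (α 2)) (hmix (α 1) (α 3)) hH
  have h5 := diff_mul_diff_mul_minor (hα 1).1 (hα 2).1 (hα 3).1 (hα 1).2 (hα 2).2 (hα 3).2 hwl hwk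
    (hmix (α 2) (α 3))
  have hA := (hα 1).1
  have hC := (hα 1).2
  set P := theta1 τ (α 1) * theta3 τ (α 1) *
    (theta1 τ (α 2) * theta3 τ (α 2) * (theta1 τ (α 3) * theta3 τ (α 3))) with hP
  -- The surviving entry b_j or a_j carries θ₁(α_j) or θ₃(α_j), which cancels one factor of the
  -- denominator.
  have eA (X : ℂ) : X / (theta1 τ (α 1) * theta3 τ (α 1) * P) * theta1 τ (α 1) =
      X / (theta3 τ (α 1) * P) := by
    field_simp
  have eC (X : ℂ) : X / (theta1 τ (α 1) * theta3 τ (α 1) * P) * theta3 τ (α 1) =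
      X / (theta1 τ (α 1) * P) := by
    field_simp
  set d := theta2 τ 0 * theta4 τ 0 * theta3 τ 0 *
    (theta1 τ (α 1 - α 2) * theta1 τ (α 1 - α 3) * theta1 τ (α 2 - α 3)) * theta2 τ (z / 2) with hd
  set Y := theta2 τ 0 * theta4 τ 0 * theta3 τ (α 1 + α 2) * theta3 τ (α 1 + α 3) *
    theta4 τ (α 2 + α 3 - z / 2) with hY
  rw [Matrix.adjugate_fin_succ_eq_det_submatrix, Matrix.det_fin_three]
  fin_cases r
  · simp only [adjVector, sum_univ_erase_zero, prod_univ_erase_zero, ← hP]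
    simp [Psi, aEntry, bEntry]
    -- Writing w = (w - w_j) + w_j in both w-rows leaves b_j times the single minor and w_j times a
    -- minor already computed.
    linear_combination theta1 τ (α 1) * theta4 τ (α 1 - z / 2) * h5 - I * ζ 1 * h3 +
      d * theta4 τ (α 1 - z / 2) * eA Y
  · simp only [adjVector, sum_univ_erase_zero, prod_univ_erase_zero, ← hP]
    simp [Psi, Fin.succAbove, aEntry, bEntry]
    linear_combination theta3 τ (α 1) * theta2 τ (α 1 - z / 2) * h5 - I * ζ 1 * h4 +
      d * theta2 τ (α 1 - z / 2) * eC Y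
  · simp only [adjVector, sum_univ_erase_zero, prod_univ_erase_zero, ← hP]
    simp [Psi, Fin.succAbove, aEntry, bEntry]
    linear_combination h3
  · simp only [adjVector, sum_univ_erase_zero, prod_univ_erase_zero, ← hP]
    simp [Psi, Fin.succAbove, aEntry, bEntry]
    linear_combination h4

/-- The columns of the transposed adjugate of `Ψ`, when `i ζ = θ₂ θ₄ / (θ₁ θ₃)` at each `α`. -/
lemma adjugate_transpose_col_Psi {τ : ℂ} (hτ : 0 < τ.im) (z : ℂ) (ζ α : Fin 4 → ℂ)
    (hα : ∀ s, theta1 τ (α s) ≠ 0 ∧ theta3 τ (α s) ≠ 0)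
    (hζ : ∀ s, I * ζ s * (theta1 τ (α s) * theta3 τ (α s)) = theta2 τ (α s) * theta4 τ (α s))
    (i j k l : Fin 4) (hijkl : [i, j, k, l].Nodup) :
    (Psi τ z ζ α).adjugate.transpose.col i =
      dFactor τ z α i j k l • adjVector τ z ζ α i j k l := by
  have hinj : Function.Injective ![i, j, k, l] := by
    rw [← List.nodup_ofFn]
    simpa using hijkl
  obtain ⟨σ, rfl, rfl, rfl, rfl⟩ : ∃ σ : Equiv.Perm (Fin 4), σ 0 = i ∧ σ 1 = j ∧ σ 2 = k ∧ σ 3 = l :=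
    ⟨Equiv.ofBijective _ (Finite.injective_iff_bijective.1 hinj), rfl, rfl, rfl, rfl⟩
  ext r
  have h := adjugate_Psi_zero hτ z (ζ ∘ σ) (α ∘ σ) (fun s => hα (σ s)) (fun s => hζ (σ s)) r
  rw [Matrix.col_apply, Matrix.transpose_apply, adjugate_submatrix_perm,
    show (Psi τ z ζ α).submatrix id σ = Psi τ z (ζ ∘ σ) (α ∘ σ) by
      ext p q; fin_cases p <;> rfl, h, adjVector_perm, Pi.smul_apply, smul_eq_mul, dFactor,
    sign_eq_leviCivita]
  simp only [Function.comp_apply]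
  ring

/-! ### The theta quotient and its differential equation -/

/-- The numerator `θ₂ θ₄` of the meromorphic function `i ζ` of the Abel image. -/
noncomputable def thetaNum (τ v : ℂ) : ℂ := theta2 τ v * theta4 τ v

/-- The denominator `θ₁ θ₃` of the meromorphic function `i ζ` of the Abel image. -/
noncomputable def thetaDen (τ v : ℂ) : ℂ := theta1 τ v * theta3 τ v

/-- The constant `θ₂(0) θ₄(0) θ₁'(0)`. -/
noncomputable def thetaWronskian (τ : ℂ) : ℂ := theta2 τ 0 * theta4 τ 0 * deriv (theta1 τ) 0

/-- The constant `θ₁'(0) θ₃(0) / (2 θ₂(0) θ₄(0))`, which turns out to be the complete elliptic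
integral. -/
noncomputable def thetaK (τ : ℂ) : ℂ :=
  deriv (theta1 τ) 0 * theta3 τ 0 / (2 * (theta2 τ 0 * theta4 τ 0))

section Differentiability

variable {τ : ℂ} (hτ : 0 < τ.im)
include hτ

lemma differentiable_theta3 : Differentiable ℂ (theta3 τ) :=
  fun v => differentiableAt_jacobiTheta₂_fst v hτ

lemma differentiable_theta4 : Differentiable ℂ (theta4 τ) :=
  (differentiable_theta3 hτ).comp (differentiable_id.add_const _)

lemma differentiable_theta2 : Differentiable ℂ (theta2 τ) := by
  have h : Differentiable ℂ fun v => theta3 τ (v + τ / 2) :=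
    (differentiable_theta3 hτ).comp (differentiable_id.add_const _)
  have h' : Differentiable ℂ fun v => cexp (Real.pi * I * (τ / 4 + v)) := by fun_prop
  exact h'.mul h

lemma differentiable_theta1 : Differentiable ℂ (theta1 τ) :=
  (differentiable_theta2 hτ).comp (differentiable_id.sub_const _)

lemma differentiable_thetaNum : Differentiable ℂ (thetaNum τ) :=
  (differentiable_theta2 hτ).mul (differentiable_theta4 hτ)

lemma differentiable_thetaDen : Differentiable ℂ (thetaDen τ) :=
  (differentiable_theta1 hτ).mul (differentiable_theta3 hτ)

/-- Differentiate `theta_addition` in its first variable on the diagonal; since θ₁(0) = 0, only the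
term with θ₁'(0) survives. -/
lemma deriv_thetaDen_mul_sub (v : ℂ) :
    deriv (thetaDen τ) v * thetaNum τ v - deriv (thetaNum τ) v * thetaDen τ v =
      thetaWronskian τ * theta3 τ (2 * v) := by
  have h1 : HasDerivAt (fun j => thetaDen τ j * thetaNum τ v - thetaNum τ j * thetaDen τ v)
      (deriv (thetaDen τ) v * thetaNum τ v - deriv (thetaNum τ) v * thetaDen τ v) v :=
    ((differentiable_thetaDen hτ v).hasDerivAt.mul_const _).sub
      ((differentiable_thetaNum hτ v).hasDerivAt.mul_const _)
  have h2 : HasDerivAt (fun j => theta2 τ 0 * theta4 τ 0 * (theta1 τ (j - v) * theta3 τ (j + v)))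
      (theta2 τ 0 * theta4 τ 0 * (deriv (theta1 τ) (v - v) * theta3 τ (v + v) +
        theta1 τ (v - v) * deriv (theta3 τ) (v + v))) v :=
    (((differentiable_theta1 hτ _).hasDerivAt.comp_sub_const v v).mul
      ((differentiable_theta3 hτ _).hasDerivAt.comp_add_const v v)).const_mul _
  have h3 : (fun j => thetaDen τ j * thetaNum τ v - thetaNum τ j * thetaDen τ v) =
      fun j => theta2 τ 0 * theta4 τ 0 * (theta1 τ (j - v) * theta3 τ (j + v)) :=
    funext fun j => theta_addition hτ j v
  rw [h3] at h1
  rw [h1.unique h2, sub_self, theta1_zero, thetaWronskian, two_mul]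
  ring

lemma hasDerivAt_thetaDen_div (v : ℂ) (hv : thetaNum τ v ≠ 0) :
    HasDerivAt (fun v => thetaDen τ v / thetaNum τ v)
      (thetaWronskian τ * theta3 τ (2 * v) / thetaNum τ v ^ 2) v := by
  have h := (differentiable_thetaDen hτ v).hasDerivAt.div
    (differentiable_thetaNum hτ v).hasDerivAt hv
  rw [mul_comm (thetaDen τ v), deriv_thetaDen_mul_sub hτ] at h
  exact h

lemma hasDerivAt_thetaNum_div (v : ℂ) (hv : thetaDen τ v ≠ 0) :
    HasDerivAt (fun v => thetaNum τ v / thetaDen τ v)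
      (-(thetaWronskian τ * theta3 τ (2 * v)) / thetaDen τ v ^ 2) v := by
  have h := (differentiable_thetaNum hτ v).hasDerivAt.div
    (differentiable_thetaDen hτ v).hasDerivAt hv
  rw [mul_comm (thetaNum τ v), ← neg_sub, deriv_thetaDen_mul_sub hτ] at h
  exact h

/-- At a common zero v the addition theorem gives θ₁(j - v)θ₃(j + v) = 0 for every j. As θ₃ is
nonzero near 0, θ₁ vanishes near -2v, hence identically, contradicting θ₂(0) ≠ 0. -/
lemma thetaNum_ne_zero_or_thetaDen_ne_zero (h2 : theta2 τ 0 ≠ 0) (h3 : theta3 τ 0 ≠ 0)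
    (h4 : theta4 τ 0 ≠ 0) (v : ℂ) : thetaNum τ v ≠ 0 ∨ thetaDen τ v ≠ 0 := by
  by_contra! hv
  have h (j : ℂ) : theta1 τ (j - v) * theta3 τ (j + v) = 0 := by
    have := theta_addition hτ j v
    rw [show theta2 τ v * theta4 τ v = 0 from hv.1, show theta1 τ v * theta3 τ v = 0 from hv.2,
      mul_zero, mul_zero, sub_zero] at this
    exact (mul_eq_zero.1 this.symm).resolve_left (mul_ne_zero h2 h4)
  have hnear : ∀ᶠ u in 𝓝 (-(2 * v)), theta1 τ u = 0 := by
    have hc : ContinuousAt (fun u => theta3 τ (u + 2 * v)) (-(2 * v)) :=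
      ((differentiable_theta3 hτ).continuous.comp (continuous_id.add continuous_const)).continuousAt
    filter_upwards [hc.eventually_ne (by simpa using h3)] with u hu
    have := h (u + v)
    rw [add_sub_cancel_right, show u + v + v = u + 2 * v by ring] at this
    exact (mul_eq_zero.1 this).resolve_right hu
  have hzero := ((differentiable_theta1 hτ).differentiableOn.analyticOnNhd
    isOpen_univ).eq_of_eventuallyEq (g := 0)
    ((differentiable_const 0).differentiableOn.analyticOnNhd isOpen_univ) hnear
  apply h2
  rw [← theta1_add_half, hzero]
  rfl

lemma theta2_zero_pow_add : theta2 τ 0 ^ 4 + theta4 τ 0 ^ 4 = theta3 τ 0 ^ 4 := by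
  have h2 := theta2_mul_theta2 0 0 hτ
  have h3 := theta3_mul_theta3 0 0 hτ
  have h4 := theta4_mul_theta4 0 0 hτ
  rw [show theta2 τ 0 ^ 4 = (theta2 τ 0 * theta2 τ 0) ^ 2 by ring,
    show theta3 τ 0 ^ 4 = (theta3 τ 0 * theta3 τ 0) ^ 2 by ring,
    show theta4 τ 0 ^ 4 = (theta4 τ 0 * theta4 τ 0) ^ 2 by ring, h2, h3, h4, add_zero, sub_zero]
  ring

/-- Over the doubled period every factor is a polynomial in θ₂ and θ₃ at 0 and 2v. The result is the
quartic of the curve in homogeneous form. -/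
lemma theta3_two_mul_sq (v : ℂ) :
    theta2 τ 0 ^ 4 * theta4 τ 0 ^ 4 * theta3 τ 0 ^ 2 * theta3 τ (2 * v) ^ 2 =
      theta3 τ 0 ^ 4 * (thetaNum τ v ^ 4 + thetaDen τ v ^ 4) -
        2 * (theta2 τ 0 ^ 4 - theta4 τ 0 ^ 4) * thetaNum τ v ^ 2 * thetaDen τ v ^ 2 := by
  have h2 := theta2_mul_theta2 0 0 hτ
  have h3 := theta3_mul_theta3 0 0 hτ
  have h4 := theta4_mul_theta4 0 0 hτ
  have k1 := theta1_mul_theta1 v v hτ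
  have k2 := theta2_mul_theta2 v v hτ
  have k3 := theta3_mul_theta3 v v hτ
  have k4 := theta4_mul_theta4 v v hτ
  have h := theta3_mul_theta3 (2 * v) 0 hτ
  simp only [add_zero, sub_zero, sub_self, ← two_mul, mul_zero] at h h2 h3 h4 k1 k2 k3 k4
  have hN : thetaNum τ v ^ 2 = theta2 τ v * theta2 τ v * (theta4 τ v * theta4 τ v) := by
    rw [thetaNum]
    ring
  have hD : thetaDen τ v ^ 2 = theta1 τ v * theta1 τ v * (theta3 τ v * theta3 τ v) := by
    rw [thetaDen]
    ring
  rw [k2, k4] at hN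
  rw [k1, k3] at hD
  rw [show theta2 τ 0 ^ 4 * theta4 τ 0 ^ 4 * theta3 τ 0 ^ 2 * theta3 τ (2 * v) ^ 2 =
      (theta2 τ 0 * theta2 τ 0) ^ 2 * (theta4 τ 0 * theta4 τ 0) ^ 2 *
        (theta3 τ (2 * v) * theta3 τ 0) ^ 2 by ring,
    show theta2 τ 0 ^ 4 = (theta2 τ 0 * theta2 τ 0) ^ 2 by ring,
    show theta3 τ 0 ^ 4 = (theta3 τ 0 * theta3 τ 0) ^ 2 by ring,
    show theta4 τ 0 ^ 4 = (theta4 τ 0 * theta4 τ 0) ^ 2 by ring,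
    show thetaNum τ v ^ 4 = (thetaNum τ v ^ 2) ^ 2 by ring,
    show thetaDen τ v ^ 4 = (thetaDen τ v ^ 2) ^ 2 by ring, h2, h3, h4, h, hN, hD]
  ring

end Differentiability

/-! ### Purely imaginary period: imaginary transformation, reality and positivity -/

section ImaginaryPeriod

variable {t : ℝ} (ht : 0 < t)

include ht in
lemma I_mul_im_pos : 0 < (I * (t : ℂ)).im := by simpa using ht

include ht in
lemma jacobiTheta₂_imaginary_pos (s : ℝ) :
    ∃ r : ℝ, 0 < r ∧ jacobiTheta₂ (I * s) (I * t) = r := by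
  have hterm (n : ℤ) : jacobiTheta₂_term n (I * s) (I * t) =
      (Real.exp (-(2 * Real.pi * n * s) - Real.pi * n ^ 2 * t) : ℝ) := by
    rw [jacobiTheta₂_term, ofReal_exp]
    congr 1
    push_cast
    linear_combination (2 * Real.pi * n * s + Real.pi * n ^ 2 * t : ℂ) * I_mul_I
  have h := hasSum_jacobiTheta₂_term (I * s) (I_mul_im_pos ht)
  simp only [hterm] at h
  have hs := Complex.summable_ofReal.1 h.summable
  refine ⟨_, hs.tsum_pos (fun n => (Real.exp_pos _).le) 0 (Real.exp_pos _), ?_⟩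
  rw [ofReal_tsum]
  exact h.tsum_eq.symm

/-- The factor `1 / √t` of the imaginary transformation. -/
noncomputable def modularFactor (t : ℝ) : ℝ := 1 / t ^ (1 / 2 : ℝ)

include ht in
lemma modularFactor_pos : 0 < modularFactor t := by
  rw [modularFactor]
  positivity

lemma div_I_mul (v w : ℂ) : v / (I * w) = -(I * (v * w⁻¹)) := by
  rw [div_eq_mul_inv, mul_inv, inv_I]
  ring

include ht in
lemma theta3_modular (v : ℂ) : theta3 (I * t) v =
    modularFactor t * cexp (-(Real.pi * v ^ 2 / t)) * theta3 (I * (t⁻¹ : ℝ)) (v / (I * t)) := by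
  have h1 : -I * (I * (t : ℂ)) = t := by linear_combination -(t : ℂ) * I_mul_I
  have h2 : -(Real.pi : ℂ) * I * v ^ 2 / (I * t) = -(Real.pi * v ^ 2 / t) := by
    rw [div_I_mul]
    linear_combination (Real.pi : ℂ) * v ^ 2 * (t : ℂ)⁻¹ * I_mul_I
  have h3 : -1 / (I * (t : ℂ)) = I * (t⁻¹ : ℝ) := by
    rw [div_I_mul]
    push_cast
    ring
  rw [theta3, theta3, jacobiTheta₂_functional_equation, h1, h2, h3, modularFactor, ofReal_div,
    ofReal_one, ofReal_cpow ht.le]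
  push_cast
  rfl

include ht in
lemma theta4_modular (v : ℂ) : theta4 (I * t) v =
    modularFactor t * cexp (-(Real.pi * v ^ 2 / t)) * theta2 (I * (t⁻¹ : ℝ)) (v / (I * t)) := by
  rw [← theta3_add_half, theta3_modular ht, ← theta2_neg (I * (t⁻¹ : ℝ)) (v / (I * t)), theta2,
    ← theta3_neg, theta3, div_I_mul, div_I_mul, mul_assoc, mul_assoc, ← mul_assoc (cexp _) (cexp _),
    ← Complex.exp_add]
  push_cast
  congr 3
  · linear_combination -(Real.pi : ℂ) * (t : ℂ)⁻¹ * (1 / 4 + v) * I_mul_I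
  · ring

include ht in
lemma theta2_modular (v : ℂ) : theta2 (I * t) v =
    modularFactor t * cexp (-(Real.pi * v ^ 2 / t)) * theta4 (I * (t⁻¹ : ℝ)) (v / (I * t)) := by
  have ht0 : (t : ℂ) * (t : ℂ)⁻¹ = 1 := mul_inv_cancel₀ (ofReal_ne_zero.2 ht.ne')
  have h1 : (Real.pi : ℂ) * I * (I * t / 4 + v) + -(Real.pi * (v + I * t / 2) ^ 2 / t) =
      -(Real.pi * v ^ 2 / t) := by
    rw [div_eq_mul_inv, div_eq_mul_inv]
    linear_combination (-(Real.pi * I * v : ℂ) - Real.pi * I * I * t / 4) * ht0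
  have h2 : -(I * ((v + I * t / 2) * (t : ℂ)⁻¹)) = -(I * (v * (t : ℂ)⁻¹)) + 1 / 2 := by
    linear_combination (-I * I / 2) * ht0 - I_mul_I / 2
  rw [theta2, ← theta3, theta3_modular ht, ← theta3_add_half, div_I_mul, div_I_mul, h2, ← h1,
    Complex.exp_add]
  ring

include ht in
lemma theta1_modular (v : ℂ) : theta1 (I * t) v =
    I * modularFactor t * cexp (-(Real.pi * v ^ 2 / t)) *
      theta1 (I * (t⁻¹ : ℝ)) (v / (I * t)) := by
  have h1 : (v - 1 / 2) / (I * t) = v / (I * t) + I * (t⁻¹ : ℝ) / 2 := by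
    rw [div_I_mul, div_I_mul]
    push_cast
    ring
  have h2 : cexp (-(Real.pi * (v - 1 / 2) ^ 2 / t)) * halfShift (I * (t⁻¹ : ℝ)) (v / (I * t)) =
      cexp (-(Real.pi * v ^ 2 / t)) := by
    rw [halfShift, ← Complex.exp_add, div_I_mul, div_eq_mul_inv, div_eq_mul_inv]
    congr 1
    push_cast
    linear_combination (Real.pi * (v - 1 / 4) * (t : ℂ)⁻¹) * I_mul_I
  rw [theta1, theta2_modular ht, h1, theta4_add_half_period, ← h2]
  ring

include ht in
-- The series on the real axis has terms of varying sign. The imaginary transformation carries x to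
-- the imaginary axis, where every term is positive.
lemma theta3_pos (x : ℝ) : ∃ r : ℝ, 0 < r ∧ theta3 (I * t) x = r := by
  have ht0 : (t : ℂ) ≠ 0 := ofReal_ne_zero.2 ht.ne'
  obtain ⟨r, hr, h⟩ := jacobiTheta₂_imaginary_pos (inv_pos.2 ht) (-x / t)
  refine ⟨modularFactor t * Real.exp (-(Real.pi * x ^ 2 / t)) * r, ?_, ?_⟩
  · have := modularFactor_pos ht
    positivity
  · rw [theta3_modular ht, theta3, show (x : ℂ) / (I * t) = I * ((-x / t : ℝ) : ℂ) by
      push_cast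
      rw [div_I_mul]
      ring, h]
    push_cast
    ring

include ht in
lemma theta4_pos (x : ℝ) : ∃ r : ℝ, 0 < r ∧ theta4 (I * t) x = r := by
  obtain ⟨r, hr, h⟩ := theta3_pos ht (x + 1 / 2)
  exact ⟨r, hr, by rw [← h, ← theta3_add_half]; push_cast; rfl⟩

include ht in
lemma theta2_zero_pos : ∃ r : ℝ, 0 < r ∧ theta2 (I * t) 0 = r := by
  obtain ⟨r, hr, h⟩ := theta4_pos (inv_pos.2 ht) 0
  refine ⟨modularFactor t * r, mul_pos (modularFactor_pos ht) hr, ?_⟩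
  rw [theta2_modular ht, zero_div, ← ofReal_zero, h]
  simp

lemma conj_theta2 (x : ℝ) : (starRingEnd ℂ) (theta2 (I * t) x) = theta2 (I * t) x := by
  rw [← theta2_neg (I * t) x, theta2_neg]
  conv_rhs => rw [← theta2_neg]
  rw [theta2, theta2, map_mul, jacobiTheta₂_conj, ← exp_conj,
    ← jacobiTheta₂_neg_left (-(x : ℂ) + _)]
  simp only [map_mul, map_add, map_div₀, conj_I, conj_ofReal, map_ofNat, neg_mul, neg_neg]
  congr 2 <;> ring

lemma conj_theta1 (x : ℝ) : (starRingEnd ℂ) (theta1 (I * t) x) = theta1 (I * t) x := by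
  have h := conj_theta2 (t := t) (x - 1 / 2)
  push_cast at h
  exact h

end ImaginaryPeriod

/-! ### Nonvanishing of θ₂ on (-1/2, 1/2) -/

lemma theta2_eq_zero_doubling {t : ℝ} (ht : 0 < t) {x : ℝ} (h : theta2 (I * t) x = 0) :
    theta2 (I * (2 * t : ℝ)) x = 0 := by
  have hm := theta2_mul_theta2 (x : ℂ) 0 (I_mul_im_pos ht)
  rw [h, zero_mul, add_zero, sub_zero, show 2 * (I * (t : ℂ)) = I * (2 * t : ℝ) by
    push_cast
    ring] at hm
  obtain ⟨r, hr, hr'⟩ := theta3_pos (mul_pos two_pos ht) x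
  rw [hr'] at hm
  have hr0 : (r : ℂ) ≠ 0 := ofReal_ne_zero.2 hr.ne'
  apply (mul_eq_zero.1 _).resolve_left (mul_ne_zero two_ne_zero hr0)
  linear_combination -hm

lemma jacobiTheta₂_add_half_period_term (t x : ℝ) (n : ℤ) :
    jacobiTheta₂_term n (x + I * t / 2) (I * t) =
      cexp (2 * Real.pi * n * x * I) * (Real.exp (-(Real.pi * (n * (n + 1)) * t)) : ℝ) := by
  rw [jacobiTheta₂_term, ofReal_exp, ← Complex.exp_add]
  congr 1
  push_cast
  linear_combination (Real.pi * n * (n + 1) * t : ℂ) * I_mul_I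

/-- The n-th term has modulus exp(-π n(n+1) t), so only n = 0 and n = -1 survive; the terms at t = 1
dominate. -/
lemma tendsto_jacobiTheta₂_add_half_period (x : ℝ) :
    Tendsto (fun t : ℝ => jacobiTheta₂ (x + I * t / 2) (I * t)) atTop
      (𝓝 (1 + cexp (-(2 * Real.pi * x * I)))) := by
  let g : ℤ → ℂ := fun n =>
    if n = 0 then 1 else if n = -1 then cexp (-(2 * Real.pi * x * I)) else 0
  have hg : ∑' n, g n = 1 + cexp (-(2 * Real.pi * x * I)) := by
    rw [tsum_eq_sum (s := {0, -1}) (fun n hn => by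
      simp only [Finset.mem_insert, Finset.mem_singleton, not_or] at hn
      simp [g, hn.1, hn.2])]
    simp [g]
  have hnn (n : ℤ) : 0 ≤ (n : ℝ) * (n + 1) := by
    have : 0 ≤ n * (n + 1) := by
      rcases le_or_gt 0 n with h | h
      · positivity
      · exact mul_nonneg_of_nonpos_of_nonpos h.le (by omega)
    exact_mod_cast this
  have hnorm (t : ℝ) (n : ℤ) : ‖jacobiTheta₂_term n (x + I * t / 2) (I * t)‖ =
      Real.exp (-(Real.pi * (n * (n + 1)) * t)) := by
    rw [jacobiTheta₂_add_half_period_term, norm_mul,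
      show (2 * Real.pi * n * x * I : ℂ) = ((2 * Real.pi * n * x : ℝ) : ℂ) * I by push_cast; ring,
      norm_exp_ofReal_mul_I, one_mul, norm_real, Real.norm_of_nonneg (Real.exp_pos _).le]
  rw [← hg]
  refine tendsto_tsum_of_dominated_convergence
    (bound := fun n => ‖jacobiTheta₂_term n (x + I * (1 : ℝ) / 2) (I * (1 : ℝ))‖) ?_ ?_ ?_
  · exact ((summable_jacobiTheta₂_term_iff _ _).2 (I_mul_im_pos one_pos)).norm
  · intro n
    simp only [jacobiTheta₂_add_half_period_term]
    by_cases h0 : n = 0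
    · simp [h0, g]
    by_cases h1 : n = -1
    · simp [h1, g]
    · have hpos : 0 < (n : ℝ) * (n + 1) := by
        refine lt_of_le_of_ne (hnn n) (Ne.symm (mul_ne_zero (Int.cast_ne_zero.2 h0) ?_))
        intro h
        apply h1
        have : ((n + 1 : ℤ) : ℝ) = 0 := by exact_mod_cast h
        have := Int.cast_eq_zero.1 this
        omega
      have hlim : Tendsto (fun t : ℝ => Real.exp (-(Real.pi * (n * (n + 1)) * t))) atTop (𝓝 0) :=
        Real.tendsto_exp_neg_atTop_nhds_zero.comp
          (tendsto_id.const_mul_atTop (mul_pos Real.pi_pos hpos))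
      have := ((continuous_ofReal.tendsto 0).comp hlim).const_mul (cexp (2 * Real.pi * n * x * I))
      simpa [g, h0, h1] using this
  · filter_upwards [eventually_ge_atTop 1] with t ht n
    rw [hnorm, hnorm]
    apply Real.exp_le_exp.2
    have := mul_nonneg Real.pi_pos.le (hnn n)
    nlinarith

/-- A zero would persist under every doubling of the period. In the limit this forces 1 + exp(-2πix)
= 0, that is cos πx = 0. -/
lemma theta2_ne_zero {t : ℝ} (ht : 0 < t) {x : ℝ} (hx : |x| < 1 / 2) : theta2 (I * t) x ≠ 0 := by
  intro h
  have hzero (n : ℕ) : theta2 (I * (2 ^ n * t : ℝ)) x = 0 := by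
    induction n with
    | zero => simpa using h
    | succ n ih =>
      have := theta2_eq_zero_doubling (by positivity) ih
      rwa [← mul_assoc, ← pow_succ'] at this
  have hlim := (tendsto_jacobiTheta₂_add_half_period x).comp
    ((tendsto_pow_atTop_atTop_of_one_lt (one_lt_two (α := ℝ))).atTop_mul_const ht)
  have hz : (fun t : ℝ => jacobiTheta₂ (x + I * t / 2) (I * t)) ∘ (fun n : ℕ => 2 ^ n * t) =
      fun _ => 0 := by
    funext n
    exact (mul_eq_zero.1 (hzero n)).resolve_left (Complex.exp_ne_zero _)
  rw [hz] at hlim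
  have h0 := tendsto_nhds_unique hlim tendsto_const_nhds
  have hcos : Real.cos (Real.pi * x) ≠ 0 := by
    have := abs_lt.1 hx
    apply (Real.cos_pos_of_mem_Ioo ⟨_, _⟩).ne' <;> nlinarith [Real.pi_pos]
  apply hcos
  apply ofReal_injective
  rw [ofReal_cos, Complex.cos, ofReal_zero]
  have he : cexp (-(2 * Real.pi * x * I)) = cexp (-(Real.pi * x : ℝ) * I) *
      cexp (-(Real.pi * x : ℝ) * I) := by
    rw [← Complex.exp_add]
    congr 1
    push_cast
    ring
  have he' : cexp ((Real.pi * x : ℝ) * I) * cexp (-(Real.pi * x : ℝ) * I) = 1 := by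
    rw [← Complex.exp_add]
    simp
  rw [he] at h0
  linear_combination cexp ((Real.pi * x : ℝ) * I) / 2 * h0 - cexp (-(Real.pi * x : ℝ) * I) / 2 * he'

lemma exists_real_theta1 (t x : ℝ) : ∃ r : ℝ, theta1 (I * t) x = r := by
  obtain ⟨r, hr⟩ := conj_eq_iff_real.1 (conj_theta1 (t := t) x)
  exact ⟨r, hr⟩

lemma exists_real_theta2 (t x : ℝ) : ∃ r : ℝ, theta2 (I * t) x = r := by
  obtain ⟨r, hr⟩ := conj_eq_iff_real.1 (conj_theta2 (t := t) x)
  exact ⟨r, hr⟩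

lemma exists_real_deriv_theta1 {t : ℝ} (ht : 0 < t) : ∃ r : ℝ, deriv (theta1 (I * t)) 0 = r := by
  have h : HasDerivAt (theta1 (I * t)) (deriv (theta1 (I * t)) 0) ((0 : ℝ) : ℂ) := by
    simpa using (differentiable_theta1 (I_mul_im_pos ht) 0).hasDerivAt
  have h1 := imCLM.hasFDerivAt.comp_hasDerivAt (0 : ℝ) h.comp_ofReal
  have h2 : (imCLM ∘ fun x : ℝ => theta1 (I * t) x) = fun _ => (0 : ℝ) := by
    funext x
    obtain ⟨r, hr⟩ := exists_real_theta1 t x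
    simp [hr]
  rw [h2] at h1
  exact ⟨_, Complex.ext rfl (h1.unique (hasDerivAt_const _ _))⟩

/-! ### Complete elliptic integrals as theta constants -/

/-- The modulus `θ₂(0)² / θ₃(0)²` belonging to the period `i t`. -/
noncomputable def thetaModulus (t : ℝ) : ℝ := (theta2 (I * t) 0 ^ 2 / theta3 (I * t) 0 ^ 2).re

lemma thetaModulus_spec {t : ℝ} (ht : 0 < t) :
    (thetaModulus t : ℂ) = theta2 (I * t) 0 ^ 2 / theta3 (I * t) 0 ^ 2 ∧
      0 < thetaModulus t ∧ thetaModulus t < 1 := by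
  obtain ⟨p2, h2, e2⟩ := theta2_zero_pos ht
  obtain ⟨p3, h3, e3⟩ := theta3_pos ht 0
  obtain ⟨p4, h4, e4⟩ := theta4_pos ht 0
  have h := theta2_zero_pow_add (I_mul_im_pos ht)
  rw [ofReal_zero] at e3 e4
  rw [e2, e3, e4] at h
  have h' : p2 ^ 4 + p4 ^ 4 = p3 ^ 4 := by exact_mod_cast h
  have hm : thetaModulus t = p2 ^ 2 / p3 ^ 2 := by
    rw [thetaModulus, e2, e3, ← ofReal_pow, ← ofReal_pow, ← ofReal_div, ofReal_re]
  refine ⟨by rw [hm, e2, e3]; push_cast; rfl, by rw [hm]; positivity, ?_⟩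
  rw [hm, div_lt_one (by positivity)]
  nlinarith [pow_pos h4 4, pow_pos h2 2, pow_pos h3 2]

lemma sin_two_mul_arctan (x : ℝ) : Real.sin (2 * Real.arctan x) = 2 * x / (1 + x ^ 2) := by
  have h : (0 : ℝ) < 1 + x ^ 2 := by positivity
  rw [Real.sin_two_mul, Real.sin_arctan, Real.cos_arctan]
  field_simp
  rw [Real.sq_sqrt h.le]

/-- The complete elliptic integral in terms of theta constants. -/
lemma ellipticK_thetaModulus {t : ℝ} (ht : 0 < t) :
    (ellipticK (thetaModulus t) : ℂ) = thetaK (I * t) := by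
  have hτ := I_mul_im_pos ht
  obtain ⟨p2, h2, e2⟩ := theta2_zero_pos ht
  obtain ⟨p3, h3, e3⟩ := theta3_pos ht 0
  obtain ⟨p4, h4, e4⟩ := theta4_pos ht 0
  obtain ⟨d1, e1⟩ := exists_real_deriv_theta1 ht
  obtain ⟨hm, hm0, hm1⟩ := thetaModulus_spec ht
  have hsum := theta2_zero_pow_add hτ
  rw [ofReal_zero] at e3 e4
  rw [e2, e3, e4] at hsum
  have hsum' : p2 ^ 4 + p4 ^ 4 = p3 ^ 4 := by exact_mod_cast hsum
  set k := thetaModulus t with hk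
  have hkp : k = p2 ^ 2 / p3 ^ 2 := by
    apply ofReal_injective
    rw [hm, e2, e3]
    push_cast
    rfl
  set κ : ℝ := d1 * p3 / (2 * (p2 * p4)) with hκ
  have hK : thetaK (I * t) = κ := by
    rw [thetaK, e1, e2, e3, e4, hκ]
    push_cast
    rfl
  rw [hK]
  congr 1
  -- Substitute u = 2 arctan x(v): as v runs from 0 to 1/4, x runs from 0 to 1 and u from 0 to π/2,
  -- while the elliptic integral has constant derivative 4κ in v.
  let x : ℝ → ℝ := fun v => (thetaDen (I * t) v / thetaNum (I * t) v).re
  have hcont : Continuous fun u : ℝ => 1 / √(1 - k ^ 2 * Real.sin u ^ 2) := by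
    refine continuous_const.div (by fun_prop) fun u => (Real.sqrt_pos.2 ?_).ne'
    nlinarith [Real.sin_sq_le_one u, sq_nonneg (Real.sin u)]
  have hG (u : ℝ) : HasDerivAt (fun u => ∫ s in (0 : ℝ)..u, 1 / √(1 - k ^ 2 * Real.sin s ^ 2))
      (1 / √(1 - k ^ 2 * Real.sin u ^ 2)) u :=
    intervalIntegral.integral_hasDerivAt_right (hcont.intervalIntegrable _ _)
      hcont.stronglyMeasurable.stronglyMeasurableAtFilter hcont.continuousAt
  have hderiv (v : ℝ) (hv : v ∈ Set.uIcc (0 : ℝ) (1 / 4)) :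
      HasDerivAt (fun v => ∫ s in (0 : ℝ)..(2 * Real.arctan (x v)),
        1 / √(1 - k ^ 2 * Real.sin s ^ 2)) (4 * κ) v := by
    rw [Set.uIcc_of_le (by norm_num)] at hv
    have hN0 : theta2 (I * t) v ≠ 0 :=
      theta2_ne_zero ht (abs_lt.2 ⟨by linarith [hv.1], by linarith [hv.2]⟩)
    obtain ⟨r1, f1⟩ := exists_real_theta1 t v
    obtain ⟨r2, f2⟩ := exists_real_theta2 t v
    obtain ⟨r3, hr3, f3⟩ := theta3_pos ht v
    obtain ⟨r4, hr4, f4⟩ := theta4_pos ht v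
    obtain ⟨r, hr, f⟩ := theta3_pos ht (2 * v)
    have hr2 : r2 ≠ 0 := by
      rintro rfl
      exact hN0 f2
    have hn : thetaNum (I * t) v = (r2 * r4 : ℝ) := by
      rw [thetaNum, f2, f4]
      push_cast
      rfl
    have hd : thetaDen (I * t) v = (r1 * r3 : ℝ) := by
      rw [thetaDen, f1, f3]
      push_cast
      rfl
    set n := r2 * r4
    set d := r1 * r3
    have hn0 : n ≠ 0 := mul_ne_zero hr2 hr4.ne'
    have hq := theta3_two_mul_sq hτ v
    rw [ofReal_mul, ofReal_ofNat] at f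
    rw [hn, hd, e2, e3, e4, f] at hq
    have hq' : p2 ^ 4 * p4 ^ 4 * p3 ^ 2 * r ^ 2 = p3 ^ 4 * (n ^ 4 + d ^ 4) -
        2 * (p2 ^ 4 - p4 ^ 4) * n ^ 2 * d ^ 2 := by exact_mod_cast hq
    have hx : x v = d / n := by
      simp only [x]
      rw [hn, hd, ← ofReal_div, ofReal_re]
    have hxd : HasDerivAt x (p2 * p4 * d1 * r / n ^ 2) v := by
      have h := (hasDerivAt_thetaDen_div hτ v (by rw [hn]; exact ofReal_ne_zero.2 hn0)).real_of_complex
      convert h using 1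
      rw [thetaWronskian, e1, e2, e4, f, hn, ← ofReal_mul, ← ofReal_mul, ← ofReal_mul,
        ← ofReal_pow, ← ofReal_div, ofReal_re]
    have hu := (hxd.arctan).const_mul 2
    have hcomp := (hG (2 * Real.arctan (x v))).comp v hu
    refine hcomp.congr_deriv ?_
    have hR : √(1 - k ^ 2 * Real.sin (2 * Real.arctan (x v)) ^ 2) =
        p2 ^ 2 * p4 ^ 2 * r / (p3 * n ^ 2 * (1 + x v ^ 2)) := by
      have hnd : n ^ 2 + d ^ 2 ≠ 0 := by positivity
      have hsq : 1 - k ^ 2 * Real.sin (2 * Real.arctan (x v)) ^ 2 =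
          (p2 ^ 2 * p4 ^ 2 * r / (p3 * n ^ 2 * (1 + x v ^ 2))) ^ 2 := by
        rw [sin_two_mul_arctan, hx, hkp,
          show 2 * (d / n) / (1 + (d / n) ^ 2) = 2 * d * n / (n ^ 2 + d ^ 2) by field_simp,
          show p3 * n ^ 2 * (1 + (d / n) ^ 2) = p3 * (n ^ 2 + d ^ 2) by field_simp]
        field_simp
        linear_combination -(2 * n ^ 2 * d ^ 2) * hsum' - hq'
      -- Positivity of θ₃(2v) selects the root.
      rw [hsq, Real.sqrt_sq (by positivity)]
    rw [hR, hκ, hx]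
    field_simp
    ring
  have hint := intervalIntegral.integral_eq_sub_of_hasDerivAt hderiv
    (continuous_const.intervalIntegrable _ _)
  have hx0 : x 0 = 0 := by
    simp [x, thetaDen, theta1_zero]
  have hx1 : x (1 / 4) = 1 := by
    have a1 : theta1 (I * t) (1 / 4) = theta2 (I * t) (1 / 4) := by
      rw [theta1, ← theta2_neg]
      norm_num
    have a3 : theta3 (I * t) (1 / 4) = theta4 (I * t) (1 / 4) := by
      rw [← theta4_neg, ← theta3_add_half]
      norm_num
    have hn : theta2 (I * t) (1 / 4) ≠ 0 := by
      have := theta2_ne_zero ht (x := 1 / 4) (by rw [abs_of_pos] <;> norm_num)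
      push_cast at this
      exact this
    obtain ⟨r4, hr4, f4⟩ := theta4_pos ht (1 / 4)
    push_cast at f4
    have hn4 : theta4 (I * t) (1 / 4) ≠ 0 := by
      rw [f4]
      exact ofReal_ne_zero.2 hr4.ne'
    simp only [x, thetaDen, thetaNum]
    push_cast
    rw [a1, a3, div_self (mul_ne_zero hn hn4), one_re]
  rw [hx0, hx1, Real.arctan_zero, Real.arctan_one, mul_zero, intervalIntegral.integral_same,
    show 2 * (Real.pi / 4) = Real.pi / 2 by ring, sub_zero, intervalIntegral.integral_const] at hint
  rw [ellipticK, ← hint]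
  simp

/-- The imaginary transformation exchanges θ₂(0) and θ₄(0), so inverting t passes to the
complementary modulus. -/
lemma thetaModulus_inv {t : ℝ} (ht : 0 < t) :
    (thetaModulus t⁻¹ : ℂ) = theta4 (I * t) 0 ^ 2 / theta3 (I * t) 0 ^ 2 := by
  have hc : (modularFactor t : ℂ) ≠ 0 := ofReal_ne_zero.2 (modularFactor_pos ht).ne'
  rw [(thetaModulus_spec (inv_pos.2 ht)).1, theta4_modular ht, theta3_modular ht, zero_div]
  simp only [ne_eq, OfNat.ofNat_ne_zero, not_false_eq_true, zero_pow, mul_zero, zero_div, neg_zero,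
    Complex.exp_zero, mul_one, mul_pow]
  rw [mul_div_mul_left _ _ (pow_ne_zero 2 hc)]

lemma thetaModulus_sq_add {t : ℝ} (ht : 0 < t) :
    thetaModulus t ^ 2 + thetaModulus t⁻¹ ^ 2 = 1 := by
  obtain ⟨p3, h3, e3⟩ := theta3_pos ht 0
  rw [ofReal_zero] at e3
  have h3' : theta3 (I * t) 0 ≠ 0 := by
    rw [e3]
    exact ofReal_ne_zero.2 h3.ne'
  have h := theta2_zero_pow_add (I_mul_im_pos ht)
  apply ofReal_injective
  push_cast
  rw [(thetaModulus_spec ht).1, thetaModulus_inv ht]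
  field_simp
  linear_combination h

lemma coModulus_thetaModulus {t : ℝ} (ht : 0 < t) :
    coModulus (thetaModulus t) = thetaModulus t⁻¹ := by
  rw [coModulus, ← thetaModulus_sq_add ht, add_sub_cancel_left,
    Real.sqrt_sq (thetaModulus_spec (inv_pos.2 ht)).2.1.le]

lemma deriv_theta1_modular {t : ℝ} (ht : 0 < t) :
    deriv (theta1 (I * t)) 0 = modularFactor t / t * deriv (theta1 (I * (t⁻¹ : ℝ))) 0 := by
  have ht0 : (t : ℂ) ≠ 0 := ofReal_ne_zero.2 ht.ne'
  have h1 : HasDerivAt (fun v : ℂ => v / (I * t)) (1 / (I * t)) 0 := (hasDerivAt_id 0).div_const _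
  have h2 : HasDerivAt (theta1 (I * (t⁻¹ : ℝ))) (deriv (theta1 (I * (t⁻¹ : ℝ))) 0) (0 / (I * t)) := by
    simpa using (differentiable_theta1 (I_mul_im_pos (inv_pos.2 ht)) 0).hasDerivAt
  have h3 : DifferentiableAt ℂ
      (fun v : ℂ => I * modularFactor t * cexp (-(Real.pi * v ^ 2 / t))) 0 := by fun_prop
  have h := h3.hasDerivAt.mul (h2.comp 0 h1)
  rw [funext (theta1_modular ht)]
  rw [show (fun v => I * modularFactor t * cexp (-(Real.pi * v ^ 2 / t)) *
      theta1 (I * (t⁻¹ : ℝ)) (v / (I * t))) = (fun v : ℂ => I * modularFactor t *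
        cexp (-(Real.pi * v ^ 2 / t))) * (theta1 (I * (t⁻¹ : ℝ)) ∘ fun v => v / (I * t)) from rfl,
    h.deriv, Function.comp_apply, zero_div, theta1_zero]
  simp only [ne_eq, OfNat.ofNat_ne_zero, not_false_eq_true, zero_pow, mul_zero, zero_div, neg_zero,
    Complex.exp_zero, mul_one, zero_add]
  field_simp

/-- The modular factors cancel between numerator and denominator; what remains is the t coming from
the chain rule for θ₁'(0). This is what makes K'/K equal to t. -/
lemma thetaK_modular {t : ℝ} (ht : 0 < t) : thetaK (I * (t⁻¹ : ℝ)) = t * thetaK (I * t) := by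
  have hc : (modularFactor t : ℂ) ≠ 0 := ofReal_ne_zero.2 (modularFactor_pos ht).ne'
  have ht0 : (t : ℂ) ≠ 0 := ofReal_ne_zero.2 ht.ne'
  obtain ⟨p2, h2, e2⟩ := theta2_zero_pos (inv_pos.2 ht)
  obtain ⟨p4, h4, e4⟩ := theta4_pos (inv_pos.2 ht) 0
  have h2' : (p2 : ℂ) ≠ 0 := ofReal_ne_zero.2 h2.ne'
  have h4' : (p4 : ℂ) ≠ 0 := ofReal_ne_zero.2 h4.ne'
  rw [ofReal_zero] at e4
  rw [thetaK, thetaK, deriv_theta1_modular ht, theta4_modular ht, theta3_modular ht,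
    theta2_modular ht, zero_div, e2, e4]
  simp only [ne_eq, OfNat.ofNat_ne_zero, not_false_eq_true, zero_pow, mul_zero, zero_div, neg_zero,
    Complex.exp_zero, mul_one]
  field_simp

lemma ellipticK_pos {k : ℝ} (h0 : 0 ≤ k) (h1 : k < 1) : 0 < ellipticK k := by
  have hpos (u : ℝ) : 0 < 1 - k ^ 2 * Real.sin u ^ 2 := by
    nlinarith [Real.sin_sq_le_one u, sq_nonneg (Real.sin u)]
  have hcont : Continuous fun u : ℝ => 1 / √(1 - k ^ 2 * Real.sin u ^ 2) :=
    continuous_const.div (by fun_prop) fun u => (Real.sqrt_pos.2 (hpos u)).ne'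
  refine intervalIntegral.intervalIntegral_pos_of_pos (hcont.intervalIntegrable _ _)
    (fun u => ?_) (by positivity)
  have := Real.sqrt_pos.2 (hpos u)
  positivity

lemma period_thetaModulus {t : ℝ} (ht : 0 < t) : period (thetaModulus t) = I * t := by
  obtain ⟨-, h0, h1⟩ := thetaModulus_spec ht
  have hK : (ellipticK (thetaModulus t) : ℂ) ≠ 0 :=
    ofReal_ne_zero.2 (ellipticK_pos h0.le h1).ne'
  rw [period, coModulus_thetaModulus ht, ellipticK_thetaModulus (inv_pos.2 ht), thetaK_modular ht,
    ← ellipticK_thetaModulus ht]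
  field_simp

lemma tendsto_jacobiTheta₂_imaginary (x : ℝ) :
    Tendsto (fun t : ℝ => jacobiTheta₂ x (I * t)) atTop (𝓝 1) := by
  have hterm (t : ℝ) (n : ℤ) : jacobiTheta₂_term n x (I * t) =
      cexp (2 * Real.pi * n * x * I) * (Real.exp (-(Real.pi * n ^ 2 * t)) : ℝ) := by
    rw [jacobiTheta₂_term, ofReal_exp, ← Complex.exp_add]
    congr 1
    push_cast
    linear_combination (Real.pi * n ^ 2 * t : ℂ) * I_mul_I
  have hnorm (t : ℝ) (n : ℤ) : ‖jacobiTheta₂_term n x (I * t)‖ =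
      Real.exp (-(Real.pi * n ^ 2 * t)) := by
    rw [hterm, norm_mul,
      show (2 * Real.pi * n * x * I : ℂ) = ((2 * Real.pi * n * x : ℝ) : ℂ) * I by push_cast; ring,
      norm_exp_ofReal_mul_I, one_mul, norm_real, Real.norm_of_nonneg (Real.exp_pos _).le]
  have hg : ∑' n : ℤ, (if n = 0 then (1 : ℂ) else 0) = 1 := by
    rw [tsum_ite_eq]
  rw [← hg]
  refine tendsto_tsum_of_dominated_convergence
    (bound := fun n => ‖jacobiTheta₂_term n x (I * (1 : ℝ))‖) ?_ ?_ ?_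
  · exact ((summable_jacobiTheta₂_term_iff _ _).2 (I_mul_im_pos one_pos)).norm
  · intro n
    simp only [hterm]
    by_cases h0 : n = 0
    · simp [h0]
    · have hpos : 0 < (n : ℝ) ^ 2 := by
        have : (n : ℝ) ≠ 0 := Int.cast_ne_zero.2 h0
        positivity
      have hlim : Tendsto (fun t : ℝ => Real.exp (-(Real.pi * n ^ 2 * t))) atTop (𝓝 0) :=
        Real.tendsto_exp_neg_atTop_nhds_zero.comp
          (tendsto_id.const_mul_atTop (mul_pos Real.pi_pos hpos))
      have := ((continuous_ofReal.tendsto 0).comp hlim).const_mul (cexp (2 * Real.pi * n * x * I))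
      simpa [h0] using this
  · filter_upwards [eventually_ge_atTop 1] with t ht n
    rw [hnorm, hnorm]
    apply Real.exp_le_exp.2
    have := mul_nonneg Real.pi_pos.le (sq_nonneg (n : ℝ))
    nlinarith

/-- Every modulus in `(0, 1)` belongs to a purely imaginary period. -/
lemma exists_thetaModulus_eq {k : ℝ} (h0 : 0 < k) (h1 : k < 1) :
    ∃ t : ℝ, 0 < t ∧ thetaModulus t = k := by
  let f : ℝ → ℝ := fun s => (theta4 (I * s) 0 ^ 2 / theta3 (I * s) 0 ^ 2).re
  have hf {s : ℝ} (hs : 0 < s) : f s = thetaModulus s⁻¹ := by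
    simp only [f]
    rw [← thetaModulus_inv hs, ofReal_re]
  have hcont : ContinuousOn f (Set.Ioi 0) := by
    intro s hs
    have hne : theta3 (I * s) 0 ≠ 0 := by
      obtain ⟨r, hr, h⟩ := theta3_pos hs 0
      rw [ofReal_zero] at h
      rw [h]
      exact ofReal_ne_zero.2 hr.ne'
    have hI : ContinuousAt (fun s : ℝ => I * (s : ℂ)) s := by fun_prop
    have hJ (v : ℂ) : ContinuousAt (fun s : ℝ => jacobiTheta₂ v (I * s)) s :=
      ContinuousAt.comp (f := fun s : ℝ => I * (s : ℂ))
        (differentiableAt_jacobiTheta₂_snd v (I_mul_im_pos hs)).continuousAt hI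
    have h4 : ContinuousAt (fun s : ℝ => theta4 (I * s) 0 ^ 2 / theta3 (I * s) 0 ^ 2) s :=
      ((hJ _).pow 2).div ((hJ _).pow 2) (pow_ne_zero 2 hne)
    exact (continuous_re.continuousAt.comp h4).continuousWithinAt
  have hlim : Tendsto f atTop (𝓝 1) := by
    have h4 : Tendsto (fun s : ℝ => theta4 (I * s) 0) atTop (𝓝 1) := by
      have := tendsto_jacobiTheta₂_imaginary (1 / 2)
      push_cast at this
      simpa only [theta4, zero_add] using this
    have h3 : Tendsto (fun s : ℝ => theta3 (I * s) 0) atTop (𝓝 1) := by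
      simpa only [theta3, ofReal_zero] using tendsto_jacobiTheta₂_imaginary 0
    have h : Tendsto (fun s : ℝ => theta4 (I * s) 0 ^ 2 / theta3 (I * s) 0 ^ 2) atTop (𝓝 1) := by
      have := (h4.pow 2).div (h3.pow 2) (by norm_num)
      rwa [one_pow, div_one] at this
    exact (continuous_re.tendsto 1).comp h
  obtain ⟨s₁, hs₁, hfs₁⟩ := ((hlim.eventually (lt_mem_nhds h1)).and (eventually_gt_atTop 0)).exists
  -- The limit at infinity only bounds f from below. A value f(s₂) > √(1 - k²) becomes f(1/s₂) < k
  -- through the relation between complementary moduli.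
  obtain ⟨s₂, hs₂, hfs₂⟩ := ((hlim.eventually (lt_mem_nhds
    (show √(1 - k ^ 2) < 1 by rw [Real.sqrt_lt' one_pos]; nlinarith [sq_pos_of_pos h0]))).and
    (eventually_gt_atTop 0)).exists
  have hlow : f s₂⁻¹ < k := by
    have hsq := thetaModulus_sq_add hfs₂
    rw [hf hfs₂] at hs₂
    rw [hf (inv_pos.2 hfs₂), inv_inv]
    have := (thetaModulus_spec (inv_pos.2 hfs₂)).2.1
    rw [Real.sqrt_lt' this] at hs₂
    exact lt_of_pow_lt_pow_left₀ 2 h0.le (by linarith)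
  obtain ⟨s, hs, hfs⟩ := isPreconnected_Ioi.intermediate_value (inv_pos.2 hfs₂) hfs₁ hcont
    ⟨hlow.le, hs₁.le⟩
  exact ⟨s⁻¹, inv_pos.2 hs, by rw [← hf hs, hfs]⟩

/-! ### Inversion of the Abel map along a path -/

/-- Local inversion of an Abelian integral: if `φ' = ω` with `ω² = P ∘ φ`, and `x' = a' y` with
`y² = P ∘ x`, then the initial values determine `(x, y) = (φ, ω) ∘ a`. -/
lemma eventually_eq_comp_of_hasDerivAt {φ ω P : ℂ → ℂ} {v₀ : ℂ}
    (hφ : ∀ᶠ v in 𝓝 v₀, HasDerivAt φ (ω v) v) (hω : ContinuousAt ω v₀) (hω₀ : ω v₀ ≠ 0)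
    (hP : ∀ᶠ v in 𝓝 v₀, ω v ^ 2 = P (φ v)) {t₀ : ℝ} {x y a g : ℝ → ℂ}
    (hx : ∀ᶠ t in 𝓝[>] t₀, HasDerivAt x (g t * y t) t)
    (ha : ∀ᶠ t in 𝓝[>] t₀, HasDerivAt a (g t) t)
    (hy : ∀ᶠ t in 𝓝[>] t₀, y t ^ 2 = P (x t))
    (hx₀ : Tendsto x (𝓝[>] t₀) (𝓝 (φ v₀))) (hy₀ : Tendsto y (𝓝[>] t₀) (𝓝 (ω v₀)))
    (ha₀ : Tendsto a (𝓝[>] t₀) (𝓝 v₀)) :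
    ∀ᶠ t in 𝓝[>] t₀, x t = φ (a t) ∧ y t = ω (a t) := by
  have hstrict := hasStrictDerivAt_of_hasDerivAt_of_continuousAt hφ hω
  let e := (hstrict.hasStrictFDerivAt_equiv hω₀).toOpenPartialHomeomorph φ
  have he : (e : ℂ → ℂ) = φ :=
    (hstrict.hasStrictFDerivAt_equiv hω₀).toOpenPartialHomeomorph_coe
  have hsource : v₀ ∈ e.source :=
    (hstrict.hasStrictFDerivAt_equiv hω₀).mem_toOpenPartialHomeomorph_source
  have htarget : φ v₀ ∈ e.target := he ▸ e.map_source hsource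
  have hinv : e.symm (φ v₀) = v₀ := by
    rw [← he]
    exact e.left_inv hsource
  have hB : Tendsto (fun t => e.symm (x t)) (𝓝[>] t₀) (𝓝 v₀) := by
    have := (e.continuousAt_symm htarget).tendsto.comp hx₀
    rwa [hinv] at this
  have hmem : ∀ᶠ t in 𝓝[>] t₀, x t ∈ e.target := hx₀ (e.open_target.mem_nhds htarget)
  have hωB := hω.tendsto.comp hB
  -- Both y and ω are square roots of P(x); a nonzero sum excludes opposite signs.
  have hne : ∀ᶠ t in 𝓝[>] t₀, y t + ω (e.symm (x t)) ≠ 0 :=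
    (hy₀.add hωB).eventually_ne (by simpa [← two_mul] using hω₀)
  have hall : ∀ᶠ t in 𝓝[>] t₀, HasDerivAt (fun t => a t - e.symm (x t)) 0 t ∧
      φ (e.symm (x t)) = x t ∧ y t = ω (e.symm (x t)) := by
    filter_upwards [hx, ha, hy, hmem, hne, hB.eventually hφ, hB.eventually hP,
      hωB.eventually_ne hω₀] with t h1 h2 h3 h4 h5 h6 h7 h8
    have hright : φ (e.symm (x t)) = x t := by
      have := e.right_inv h4
      rwa [he] at this
    have hyω : y t = ω (e.symm (x t)) := by
      have : (y t - ω (e.symm (x t))) * (y t + ω (e.symm (x t))) = 0 := by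
        rw [hright] at h7
        linear_combination h3 - h7
      exact sub_eq_zero.1 ((mul_eq_zero.1 this).resolve_right h5)
    have hd : HasDerivAt e.symm (ω (e.symm (x t)))⁻¹ (x t) :=
      e.hasDerivAt_symm h4 h8 (by rw [he]; exact h6)
    have hcomp : HasDerivAt (fun t => e.symm (x t)) ((ω (e.symm (x t)))⁻¹ * (g t * y t)) t :=
      hd.comp t h1
    refine ⟨(h2.sub hcomp).congr_deriv ?_, hright, hyω⟩
    rw [hyω]
    have : ω (e.symm (x t)) ≠ 0 := h8
    field_simp
    ring
  obtain ⟨b, hb, hIoo⟩ := mem_nhdsGT_iff_exists_Ioo_subset.1 hall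
  -- The difference has zero derivative and tends to 0 at t₀.
  have hconst : ∀ t ∈ Set.Ioo t₀ b, a t = e.symm (x t) := by
    intro t ht
    have hlim : Tendsto (fun t => a t - e.symm (x t)) (𝓝[>] t₀) (𝓝 0) := by
      simpa using ha₀.sub hB
    have heq : (fun _ => a t - e.symm (x t)) =ᶠ[𝓝[>] t₀] fun t => a t - e.symm (x t) := by
      filter_upwards [Ioo_mem_nhdsGT hb] with s hs
      exact isOpen_Ioo.is_const_of_deriv_eq_zero isPreconnected_Ioo
        (fun r hr => (hIoo hr).1.differentiableAt.differentiableWithinAt)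
        (fun r hr => (hIoo hr).1.deriv) ht hs
    exact sub_eq_zero.1 (tendsto_nhds_unique (tendsto_const_nhds.congr' heq) hlim)
  filter_upwards [Ioo_mem_nhdsGT hb] with t ht
  rw [hconst t ht]
  exact ⟨(hIoo ht).2.1.symm, (hIoo ht).2.2⟩

section Path

variable {k : ℝ} {ζ η : ℝ → ℂ} {ζ₀ η₀ : ℂ}

lemma IsPathFromInfinity.hasDerivAt_zeta (h : IsPathFromInfinity k ζ η ζ₀ η₀) {t : ℝ}
    (ht : t ∈ Set.Ioo (0 : ℝ) 1) : HasDerivAt ζ (deriv ζ t) t :=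
  ((h.contDiffOn_zeta.differentiableOn one_ne_zero).differentiableAt
    (Ioc_mem_nhds ht.1 ht.2)).hasDerivAt

lemma IsPathFromInfinity.hasDerivAt_eta (h : IsPathFromInfinity k ζ η ζ₀ η₀) {t : ℝ}
    (ht : t ∈ Set.Ioo (0 : ℝ) 1) : HasDerivAt η (deriv η t) t :=
  ((h.contDiffOn_eta.differentiableOn one_ne_zero).differentiableAt
    (Ioc_mem_nhds ht.1 ht.2)).hasDerivAt

lemma IsPathFromInfinity.continuousOn_integrand (h : IsPathFromInfinity k ζ η ζ₀ η₀) :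
    ContinuousOn (fun t => deriv ζ t / (4 * η t)) (Set.Ioo 0 1) := by
  have h1 : ContinuousOn (deriv ζ) (Set.Ioo 0 1) :=
    (h.contDiffOn_zeta.mono Set.Ioo_subset_Ioc_self).continuousOn_deriv_of_isOpen isOpen_Ioo le_rfl
  have h2 : ContinuousOn η (Set.Ioo 0 1) :=
    h.contDiffOn_eta.continuousOn.mono Set.Ioo_subset_Ioc_self
  exact h1.div (continuousOn_const.mul h2) fun t ht => mul_ne_zero (by norm_num) (h.eta_ne_zero t ht)

/-- Differentiating the equation of the curve along a path. -/
lemma IsPathFromInfinity.eta_mul_deriv (h : IsPathFromInfinity k ζ η ζ₀ η₀) {t : ℝ}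
    (ht : t ∈ Set.Ioo (0 : ℝ) 1) :
    2 * η t * deriv η t + (ellipticK k : ℂ) ^ 2 / 4 *
      (4 * ζ t ^ 3 + 4 * ((k : ℂ) ^ 2 - (coModulus k : ℂ) ^ 2) * ζ t) * deriv ζ t = 0 := by
  have hζ := h.hasDerivAt_zeta ht
  have hη := h.hasDerivAt_eta ht
  have hd : HasDerivAt (fun s => η s ^ 2 + (ellipticK k : ℂ) ^ 2 / 4 *
      (ζ s ^ 4 + 2 * ((k : ℂ) ^ 2 - (coModulus k : ℂ) ^ 2) * ζ s ^ 2 + 1)) _ t :=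
    (hη.pow 2).add ((((hζ.pow 4).add ((hζ.pow 2).const_mul
      (2 * ((k : ℂ) ^ 2 - (coModulus k : ℂ) ^ 2)))).add_const 1).const_mul
        ((ellipticK k : ℂ) ^ 2 / 4))
  have hzero : (fun s => η s ^ 2 + (ellipticK k : ℂ) ^ 2 / 4 *
      (ζ s ^ 4 + 2 * ((k : ℂ) ^ 2 - (coModulus k : ℂ) ^ 2) * ζ s ^ 2 + 1)) =ᶠ[𝓝 t]
        fun _ => 0 := by
    filter_upwards [Ioc_mem_nhds ht.1 ht.2] with s hs
    exact (h.onCurve s hs).symm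
  have hd' := hd.unique ((hasDerivAt_const t (0 : ℂ)).congr_of_eventuallyEq hzero)
  rw [← hd']
  push_cast
  ring

lemma sq_add_coModulus_sq (hk0 : 0 < k) (hk1 : k < 1) :
    (k : ℂ) ^ 2 + (coModulus k : ℂ) ^ 2 = 1 := by
  have h : coModulus k ^ 2 = 1 - k ^ 2 := Real.sq_sqrt (by nlinarith)
  have h' : (coModulus k : ℂ) ^ 2 = 1 - (k : ℂ) ^ 2 := by exact_mod_cast h
  rw [h']
  ring

/-- The branch points of the curve are simple. -/
lemma branch_point_simple (hk0 : 0 < k) (hk1 : k < 1) {z : ℂ} (hz : OnCurve k z 0) :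
    4 * z ^ 3 + 4 * ((k : ℂ) ^ 2 - (coModulus k : ℂ) ^ 2) * z ≠ 0 := by
  have hK : (ellipticK k : ℂ) ≠ 0 := ofReal_ne_zero.2 (ellipticK_pos hk0.le hk1).ne'
  have hc := sq_add_coModulus_sq hk0 hk1
  have hk0' : (k : ℂ) ≠ 0 := ofReal_ne_zero.2 hk0.ne'
  have hk1' : (coModulus k : ℂ) ≠ 0 :=
    ofReal_ne_zero.2 (Real.sqrt_pos.2 (by nlinarith)).ne'
  have hp : z ^ 4 + 2 * ((k : ℂ) ^ 2 - (coModulus k : ℂ) ^ 2) * z ^ 2 + 1 = 0 := by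
    have h : (ellipticK k : ℂ) ^ 2 / 4 *
        (z ^ 4 + 2 * ((k : ℂ) ^ 2 - (coModulus k : ℂ) ^ 2) * z ^ 2 + 1) = 0 := by
      rw [OnCurve] at hz
      linear_combination -hz
    exact (mul_eq_zero.1 h).resolve_left (div_ne_zero (pow_ne_zero 2 hK) (by norm_num))
  intro h
  have h' : z * (z ^ 2 + ((k : ℂ) ^ 2 - (coModulus k : ℂ) ^ 2)) = 0 := by linear_combination h / 4
  rcases mul_eq_zero.1 h' with h0 | h0
  · rw [h0] at hp
    norm_num at hp
  -- At z² = k'² - k² the quartic equals 1 - (k² - k'²)² = 4k²k'².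
  · have : (2 * (k : ℂ) * coModulus k) ^ 2 = 0 := by
      linear_combination hp - (z ^ 2 + ((k : ℂ) ^ 2 - (coModulus k : ℂ) ^ 2)) * h0 +
        ((k : ℂ) ^ 2 + (coModulus k : ℂ) ^ 2 + 1) * hc
    exact pow_ne_zero 2 (mul_ne_zero (mul_ne_zero two_ne_zero hk0') hk1') this

/-- The path may end at a branch point, where η = 0. There the differentiated curve equation
replaces dζ/η by a multiple of dη divided by the ζ-derivative of the quartic, which is continuous up
to the end because branch points are simple. -/
lemma IsPathFromInfinity.intervalIntegrable (hk0 : 0 < k) (hk1 : k < 1)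
    (h : IsPathFromInfinity k ζ η ζ₀ η₀) {t : ℝ} (ht : t ∈ Set.Ioo (0 : ℝ) 1) :
    IntervalIntegrable (fun t => deriv ζ t / (4 * η t)) MeasureTheory.volume t 1 := by
  have hK : (ellipticK k : ℂ) ≠ 0 := ofReal_ne_zero.2 (ellipticK_pos hk0.le hk1).ne'
  have hone : (1 : ℝ) ∈ Set.Ioc (0 : ℝ) 1 := ⟨one_pos, le_rfl⟩
  suffices hend : ∃ s ∈ Set.Ioo (0 : ℝ) 1,
      IntervalIntegrable (fun t => deriv ζ t / (4 * η t)) MeasureTheory.volume s 1 by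
    obtain ⟨s, hs, hint⟩ := hend
    refine IntervalIntegrable.trans ?_ hint
    exact (h.continuousOn_integrand.mono (Set.ordConnected_Ioo.uIcc_subset ht hs)).intervalIntegrable
  have hζc := h.contDiffOn_zeta.continuousOn
  have hηc := h.contDiffOn_eta.continuousOn
  have hζd := h.contDiffOn_zeta.continuousOn_derivWithin (uniqueDiffOn_Ioc 0 1) le_rfl
  have hηd := h.contDiffOn_eta.continuousOn_derivWithin (uniqueDiffOn_Ioc 0 1) le_rfl
  have hw {f : ℝ → ℂ} {s : ℝ} (hs : s ∈ Set.Ioo (0 : ℝ) 1) :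
      derivWithin f (Set.Ioc 0 1) s = deriv f s :=
    derivWithin_of_mem_nhds (Ioc_mem_nhds hs.1 hs.2)
  -- a function that is nonzero at the end is nonzero on a closed interval up to the end
  have hnear {f : ℝ → ℂ} (hf : ContinuousOn f (Set.Ioc 0 1)) (hf1 : f 1 ≠ 0) :
      ∃ s ∈ Set.Ioo (0 : ℝ) 1, ∀ r ∈ Set.Icc s 1, f r ≠ 0 := by
    have hev : ∀ᶠ r in 𝓝[≤] (1 : ℝ), f r ≠ 0 := by
      have := (hf 1 hone).eventually_ne hf1
      rwa [nhdsWithin_Ioc_eq_nhdsLE one_pos] at this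
    obtain ⟨l, hl, hsub⟩ := mem_nhdsLE_iff_exists_Icc_subset.1 hev
    refine ⟨max l (1 / 2), ⟨by positivity, max_lt hl (by norm_num)⟩, fun r hr => ?_⟩
    exact hsub ⟨(le_max_left _ _).trans hr.1, hr.2⟩
  by_cases hη1 : η 1 = 0
  · have hq1 := branch_point_simple hk0 hk1 (hη1 ▸ h.onCurve 1 hone)
    obtain ⟨s, hs, hne⟩ := hnear (f := fun r => 4 * ζ r ^ 3 +
      4 * ((k : ℂ) ^ 2 - (coModulus k : ℂ) ^ 2) * ζ r) (by fun_prop) hq1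
    refine ⟨s, hs, ?_⟩
    have hsub : Set.Icc s 1 ⊆ Set.Ioc 0 1 := fun r hr => ⟨hs.1.trans_le hr.1, hr.2⟩
    have hcont : ContinuousOn (fun r => -(2 * derivWithin η (Set.Ioc 0 1) r) /
        ((ellipticK k : ℂ) ^ 2 * (4 * ζ r ^ 3 +
          4 * ((k : ℂ) ^ 2 - (coModulus k : ℂ) ^ 2) * ζ r))) (Set.uIcc s 1) := by
      rw [Set.uIcc_of_le hs.2.le]
      have h1 := hηd.mono hsub
      have h2 := hζc.mono hsub
      refine ContinuousOn.div (by fun_prop) (by fun_prop) fun r hr => ?_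
      exact mul_ne_zero (pow_ne_zero 2 hK) (hne r hr)
    refine hcont.intervalIntegrable.congr_uIoo fun r hr => ?_
    rw [Set.uIoo_of_le hs.2.le] at hr
    have hr' : r ∈ Set.Ioo (0 : ℝ) 1 := ⟨hs.1.trans hr.1, hr.2⟩
    have hq := hne r ⟨hr.1.le, hr.2.le⟩
    have hηr := h.eta_ne_zero r hr'
    simp only [hw hr']
    rw [div_eq_div_iff (mul_ne_zero (pow_ne_zero 2 hK) hq) (mul_ne_zero (by norm_num) hηr)]
    linear_combination -4 * h.eta_mul_deriv hr'
  · obtain ⟨s, hs, hne⟩ := hnear hηc hη1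
    refine ⟨s, hs, ?_⟩
    have hsub : Set.Icc s 1 ⊆ Set.Ioc 0 1 := fun r hr => ⟨hs.1.trans_le hr.1, hr.2⟩
    have hcont : ContinuousOn (fun r => derivWithin ζ (Set.Ioc 0 1) r / (4 * η r))
        (Set.uIcc s 1) := by
      rw [Set.uIcc_of_le hs.2.le]
      exact (hζd.mono hsub).div (continuousOn_const.mul (hηc.mono hsub)) fun r hr =>
        mul_ne_zero (by norm_num) (hne r hr)
    refine hcont.intervalIntegrable.congr_uIoo fun r hr => ?_
    rw [Set.uIoo_of_le hs.2.le] at hr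
    simp only [hw (show r ∈ Set.Ioo (0 : ℝ) 1 from ⟨hs.1.trans hr.1, hr.2⟩)]

end Path

/-- The differential equation of the quotient `θ₁ θ₃ / (θ₂ θ₄)`, with denominators cleared. -/
lemma thetaWronskian_sq {τ : ℂ} (hτ : 0 < τ.im) (h2 : theta2 τ 0 ≠ 0) (h3 : theta3 τ 0 ≠ 0)
    (h4 : theta4 τ 0 ≠ 0) (v : ℂ) :
    (thetaWronskian τ * theta3 τ (2 * v)) ^ 2 = 4 * thetaK τ ^ 2 *
      (thetaNum τ v ^ 4 - 2 * ((theta2 τ 0 ^ 4 - theta4 τ 0 ^ 4) / theta3 τ 0 ^ 4) *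
        thetaNum τ v ^ 2 * thetaDen τ v ^ 2 + thetaDen τ v ^ 4) := by
  have h := theta3_two_mul_sq hτ v
  rw [thetaWronskian, thetaK]
  field_simp
  linear_combination 4 * deriv (theta1 τ) 0 ^ 2 * h

/-- Inversion of the Abel map along a path. -/
lemma theta_inversion {t₀ : ℝ} (ht₀ : 0 < t₀) {ζ₀ η₀ α : ℂ}
    (habel : IsAbelImage (thetaModulus t₀) ζ₀ η₀ α) :
    thetaDen (I * t₀) α ≠ 0 ∧ I * ζ₀ * thetaDen (I * t₀) α = thetaNum (I * t₀) α := by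
  obtain ⟨ζ, η, hpath, hα⟩ := habel
  obtain ⟨hm, hk0, hk1⟩ := thetaModulus_spec ht₀
  have hτ := I_mul_im_pos ht₀
  have hK := ellipticK_thetaModulus ht₀
  have hk' : (coModulus (thetaModulus t₀) : ℂ) = theta4 (I * t₀) 0 ^ 2 / theta3 (I * t₀) 0 ^ 2 := by
    rw [coModulus_thetaModulus ht₀, thetaModulus_inv ht₀]
  have hK0 : (ellipticK (thetaModulus t₀) : ℂ) ≠ 0 :=
    ofReal_ne_zero.2 (ellipticK_pos hk0.le hk1).ne'
  have h2 : theta2 (I * t₀) 0 ≠ 0 := by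
    obtain ⟨r, hr, h⟩ := theta2_zero_pos ht₀
    exact h ▸ ofReal_ne_zero.2 hr.ne'
  have h3 : theta3 (I * t₀) 0 ≠ 0 := by
    obtain ⟨r, hr, h⟩ := theta3_pos ht₀ 0
    rw [ofReal_zero] at h
    exact h ▸ ofReal_ne_zero.2 hr.ne'
  have h4 : theta4 (I * t₀) 0 ≠ 0 := by
    obtain ⟨r, hr, h⟩ := theta4_pos ht₀ 0
    rw [ofReal_zero] at h
    exact h ▸ ofReal_ne_zero.2 hr.ne'
  have hW := thetaWronskian_sq hτ h2 h3 h4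
  have hcommon := thetaNum_ne_zero_or_thetaDen_ne_zero hτ h2 h3 h4
  have hc : (thetaModulus t₀ : ℂ) ^ 2 - (coModulus (thetaModulus t₀) : ℂ) ^ 2 =
      (theta2 (I * t₀) 0 ^ 4 - theta4 (I * t₀) 0 ^ 4) / theta3 (I * t₀) 0 ^ 4 := by
    rw [hm, hk']
    field_simp
  have hNc := (differentiable_thetaNum hτ).continuous
  have hDc := (differentiable_thetaDen hτ).continuous
  have h3c := (differentiable_theta3 hτ).continuous
  rw [← hc, ← hK] at hW
  set τ : ℂ := I * t₀ with hτdef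
  set k := thetaModulus t₀
  set K : ℂ := (ellipticK k : ℂ) with hKdef
  set c : ℂ := (k : ℂ) ^ 2 - (coModulus k : ℂ) ^ 2 with hcdef
  set C := thetaWronskian τ with hC
  let g : ℝ → ℂ := fun t => deriv ζ t / (4 * η t)
  -- The running Abel integral, written backwards from the endpoint so that A(1) = α; its limit at
  -- ∞₁ is 0.
  let A : ℝ → ℂ := fun t => α - ∫ s in t..1, g s
  have hA {t : ℝ} (ht : t ∈ Set.Ioo (0 : ℝ) 1) : HasDerivAt A (g t) t := by
    have h := (intervalIntegral.integral_hasDerivAt_left (hpath.intervalIntegrable hk0 hk1 ht)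
      (hpath.continuousOn_integrand.stronglyMeasurableAtFilter isOpen_Ioo t ht)
      (hpath.continuousOn_integrand.continuousAt (isOpen_Ioo.mem_nhds ht))).const_sub α
    rwa [neg_neg] at h
  have hA0 : Tendsto A (𝓝[>] 0) (𝓝 0) := by
    simpa [A, g] using hα.const_sub α
  have hcurve {t : ℝ} (ht : t ∈ Set.Ioc (0 : ℝ) 1) :
      (4 * I * η t) ^ 2 = 4 * K ^ 2 * ((I * ζ t) ^ 4 - 2 * c * (I * ζ t) ^ 2 + 1) := by
    have h := hpath.onCurve t ht
    rw [OnCurve] at h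
    have hI := I_sq
    linear_combination 16 * h + (16 * η t ^ 2 - 4 * K ^ 2 * ((I ^ 2 - 1) * ζ t ^ 4 -
      2 * c * ζ t ^ 2)) * hI
  have hw {t : ℝ} (ht : t ∈ Set.Ioo (0 : ℝ) 1) :
      HasDerivAt (fun t => I * ζ t) (g t * (4 * I * η t)) t := by
    refine ((hpath.hasDerivAt_zeta ht).const_mul I).congr_deriv ?_
    have := hpath.eta_ne_zero t ht
    simp only [g]
    field_simp
  -- Parameters where the theta quotient gives the point; the second condition records dw/dα = 4iη
  -- and thereby the sheet.
  let S : Set ℝ := {t | I * ζ t * thetaDen τ (A t) = thetaNum τ (A t) ∧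
    4 * I * η t * thetaDen τ (A t) ^ 2 = -(C * theta3 τ (2 * A t))}
  have hSD {t : ℝ} (ht : t ∈ S) : thetaDen τ (A t) ≠ 0 := by
    intro h
    rcases hcommon (A t) with h' | h'
    · exact h' (by rw [← ht.1, h, mul_zero])
    · exact h' h
  have hunit : ∀ᶠ t in 𝓝[>] (0 : ℝ), t ∈ Set.Ioo (0 : ℝ) 1 := Ioo_mem_nhdsGT one_pos
  have hN0 : thetaNum τ 0 ≠ 0 := mul_ne_zero h2 h4
  -- the path starts in the coordinate `1 / w` at infinity
  have hstart : ∀ᶠ t in 𝓝[>] (0 : ℝ), t ∈ S := by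
    have hζne : ∀ᶠ t in 𝓝[>] (0 : ℝ), ζ t ≠ 0 := by
      filter_upwards [hpath.tendsto_zeta.eventually (eventually_gt_atTop 0)] with t ht
      exact norm_pos_iff.1 ht
    have hx₀ : Tendsto (fun t => (I * ζ t)⁻¹) (𝓝[>] 0) (𝓝 (thetaDen τ 0 / thetaNum τ 0)) := by
      have : thetaDen τ 0 / thetaNum τ 0 = 0 := by rw [thetaDen, theta1_zero, zero_mul, zero_div]
      rw [this]
      apply tendsto_inv₀_cobounded.comp
      rw [← tendsto_norm_atTop_iff_cobounded]
      simpa using hpath.tendsto_zeta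
    -- The prescribed limit η/ζ² → -iK/2 gives 4iη/ζ² → 2K, the same square root as this one.
    have hω₀ : C * theta3 τ (2 * 0) / thetaNum τ 0 ^ 2 = 2 * K := by
      rw [hK, thetaK, hC, thetaWronskian, thetaNum, mul_zero]
      field_simp
    have hy₀ : Tendsto (fun t => -(4 * I * η t) / (I * ζ t) ^ 2) (𝓝[>] 0)
        (𝓝 (C * theta3 τ (2 * 0) / thetaNum τ 0 ^ 2)) := by
      have := hpath.tendsto_sheet.const_mul (4 * I)
      rw [hω₀]
      rw [show 4 * I * -(I * K / 2) = 2 * K by linear_combination -2 * K * I_sq] at this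
      refine this.congr fun t => ?_
      rw [mul_pow, I_sq]
      ring
    have hnear : ∀ᶠ v in 𝓝 (0 : ℂ), thetaNum τ v ≠ 0 := hNc.continuousAt.eventually_ne hN0
    have hloc := eventually_eq_comp_of_hasDerivAt (v₀ := 0) (t₀ := 0)
      (φ := fun v => thetaDen τ v / thetaNum τ v)
      (ω := fun v => C * theta3 τ (2 * v) / thetaNum τ v ^ 2)
      (P := fun x => 4 * K ^ 2 * (1 - 2 * c * x ^ 2 + x ^ 4))
      (x := fun t => (I * ζ t)⁻¹) (y := fun t => -(4 * I * η t) / (I * ζ t) ^ 2) (a := A) (g := g)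
      (by filter_upwards [hnear] with v hv using hasDerivAt_thetaDen_div hτ v hv)
      ((continuous_const.mul (h3c.comp (continuous_const.mul continuous_id))).continuousAt.div
        (hNc.pow 2).continuousAt (pow_ne_zero 2 hN0))
      (by simpa only [hω₀] using mul_ne_zero two_ne_zero hK0)
      (by
        filter_upwards [hnear] with v hv
        rw [div_pow, hW v]
        field_simp)
      (by
        filter_upwards [hunit, hζne] with t ht hζt
        refine ((hw ht).inv (mul_ne_zero I_ne_zero hζt)).congr_deriv ?_
        ring)
      (by filter_upwards [hunit] with t ht using hA ht)
      (by
        filter_upwards [hunit, hζne] with t ht hζt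
        have hwt := mul_ne_zero I_ne_zero hζt
        rw [div_pow, neg_sq, hcurve ⟨ht.1, ht.2.le⟩]
        generalize I * ζ t = w at hwt
        field_simp)
      hx₀ hy₀ hA0
    filter_upwards [hloc, hζne, hA0.eventually hnear] with t ht hζt hNt
    have hwt := mul_ne_zero I_ne_zero hζt
    have e1 : I * ζ t * thetaDen τ (A t) = thetaNum τ (A t) := by
      have := ht.1
      field_simp at this
      linear_combination -this
    refine ⟨e1, ?_⟩
    have e2 := ht.2
    rw [div_eq_div_iff (pow_ne_zero 2 hwt) (pow_ne_zero 2 hNt), ← e1] at e2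
    apply mul_left_cancel₀ (pow_ne_zero 2 hwt)
    linear_combination -e2
  obtain ⟨a, haS, ha⟩ := (hstart.and hunit).exists
  have hsub : Set.Icc a 1 ⊆ Set.Ioc 0 1 := fun r hr => ⟨ha.1.trans_le hr.1, hr.2⟩
  have hAc : ContinuousOn A (Set.Icc a 1) := by
    have hint := hpath.intervalIntegrable hk0 hk1 ha
    have := intervalIntegral.continuousOn_primitive_interval_left
      ((intervalIntegrable_iff_integrableOn_Icc_of_le ha.2.le).1 hint |>.mono_set
        (Set.uIcc_of_le ha.2.le).subset)
    rw [Set.uIcc_of_le ha.2.le] at this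
    exact continuousOn_const.sub this
  have hζc := hpath.contDiffOn_zeta.continuousOn.mono hsub
  have hηc := hpath.contDiffOn_eta.continuousOn.mono hsub
  have hDA : ContinuousOn (fun t => thetaDen τ (A t)) (Set.Icc a 1) := hDc.comp_continuousOn hAc
  have hNA : ContinuousOn (fun t => thetaNum τ (A t)) (Set.Icc a 1) := hNc.comp_continuousOn hAc
  have h3A : ContinuousOn (fun t => theta3 τ (2 * A t)) (Set.Icc a 1) :=
    h3c.comp_continuousOn (continuousOn_const.mul hAc)
  have hclosed : IsClosed (S ∩ Set.Icc a 1) := by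
    have hf : ContinuousOn (fun t => (I * ζ t * thetaDen τ (A t) - thetaNum τ (A t),
        4 * I * η t * thetaDen τ (A t) ^ 2 + C * theta3 τ (2 * A t))) (Set.Icc a 1) := by
      fun_prop
    have := hf.preimage_isClosed_of_isClosed isClosed_Icc (isClosed_singleton (x := (0, 0)))
    convert this using 1
    ext t
    simp only [S, Set.mem_inter_iff, Set.mem_ofPred_eq, Set.mem_preimage, Set.mem_singleton_iff,
      Prod.mk.injEq, sub_eq_zero, add_eq_zero_iff_eq_neg]
    tauto
  -- Continuation to the right needs η ≠ 0, so it is made only at s < 1; the endpoint, possibly a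
  -- branch point, is reached by closedness.
  have hcover : Set.Icc a 1 ⊆ S := by
    refine hclosed.Icc_subset_of_forall_mem_nhdsWithin haS fun s hs => ?_
    have hs01 : s ∈ Set.Ioo (0 : ℝ) 1 := ⟨ha.1.trans_le hs.2.1, hs.2.2⟩
    have hD := hSD hs.1
    have hmem : ∀ᶠ t in 𝓝[>] s, t ∈ Set.Ioo (0 : ℝ) 1 :=
      mem_nhdsWithin_of_mem_nhds (isOpen_Ioo.mem_nhds hs01)
    have hφs : thetaNum τ (A s) / thetaDen τ (A s) = I * ζ s := by
      rw [div_eq_iff hD, hs.1.1]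
    have hωs : -(C * theta3 τ (2 * A s)) / thetaDen τ (A s) ^ 2 = 4 * I * η s := by
      rw [div_eq_iff (pow_ne_zero 2 hD), hs.1.2]
    have hnear : ∀ᶠ v in 𝓝 (A s), thetaDen τ v ≠ 0 := hDc.continuousAt.eventually_ne hD
    have hζs : ContinuousAt ζ s := (hpath.hasDerivAt_zeta hs01).continuousAt
    have hηs : ContinuousAt η s := (hpath.hasDerivAt_eta hs01).continuousAt
    have hAs := (hA hs01).continuousAt
    have hloc := eventually_eq_comp_of_hasDerivAt (v₀ := A s) (t₀ := s)
      (φ := fun v => thetaNum τ v / thetaDen τ v)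
      (ω := fun v => -(C * theta3 τ (2 * v)) / thetaDen τ v ^ 2)
      (P := fun x => 4 * K ^ 2 * (x ^ 4 - 2 * c * x ^ 2 + 1))
      (x := fun t => I * ζ t) (y := fun t => 4 * I * η t) (a := A) (g := g)
      (by filter_upwards [hnear] with v hv using hasDerivAt_thetaNum_div hτ v hv)
      ((continuous_const.mul (h3c.comp (continuous_const.mul continuous_id))).neg.continuousAt.div
        (hDc.pow 2).continuousAt (pow_ne_zero 2 hD))
      (by
        simp only [hωs]
        exact mul_ne_zero (mul_ne_zero (by norm_num) I_ne_zero) (hpath.eta_ne_zero s hs01))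
      (by
        filter_upwards [hnear] with v hv
        rw [div_pow, neg_sq, hW v]
        field_simp)
      (by filter_upwards [hmem] with t ht using hw ht)
      (by filter_upwards [hmem] with t ht using hA ht)
      (by filter_upwards [hmem] with t ht using hcurve ⟨ht.1, ht.2.le⟩)
      (by
        simp only [hφs]
        exact (continuousAt_const.mul hζs).continuousWithinAt)
      (by
        simp only [hωs]
        exact (continuousAt_const.mul hηs).continuousWithinAt)
      hAs.continuousWithinAt
    filter_upwards [hloc, (hAs.continuousWithinAt (s := Set.Ioi s)).eventually hnear] with t ht hDt
    refine ⟨?_, ?_⟩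
    · rw [ht.1, div_mul_cancel₀ _ hDt]
    · rw [ht.2, div_mul_cancel₀ _ (pow_ne_zero 2 hDt)]
  have h1 : (1 : ℝ) ∈ S := hcover ⟨ha.2.le, le_rfl⟩
  have hA1 : A 1 = α := by simp [A]
  have hend := hSD h1
  have heq := h1.1
  rw [hA1] at hend heq
  rw [hpath.zeta_one] at heq
  exact ⟨hend, heq⟩

end MonopoleCurve

theorem theorem7p1 (κ : ℝ) (hκ0 : 0 < κ) (hκ1 : κ < 1) (ζ η α : Fin 4 → ℂ)
    (hcurve : ∀ s, MonopoleCurve.OnCurve κ (ζ s) (η s))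
    (habel : ∀ s, MonopoleCurve.IsAbelImage κ (ζ s) (η s) (α s)) (z : ℂ) :
    -- no denominator of the formula vanishes
    (∀ s, MonopoleCurve.theta1 (MonopoleCurve.period κ) (α s) ≠ 0 ∧
      MonopoleCurve.theta3 (MonopoleCurve.period κ) (α s) ≠ 0) ∧
    ∀ i j k l : Fin 4, [i, j, k, l].Nodup →
      (MonopoleCurve.Psi (MonopoleCurve.period κ) z ζ α).adjugate.transpose.col i =
        MonopoleCurve.dFactor (MonopoleCurve.period κ) z α i j k l •
          MonopoleCurve.adjVector (MonopoleCurve.period κ) z ζ α i j k l := by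
  obtain ⟨t, ht, rfl⟩ := MonopoleCurve.exists_thetaModulus_eq hκ0 hκ1
  rw [MonopoleCurve.period_thetaModulus ht]
  have hinv := fun s => MonopoleCurve.theta_inversion ht (habel s)
  have hne : ∀ s, MonopoleCurve.theta1 (Complex.I * t) (α s) ≠ 0 ∧
      MonopoleCurve.theta3 (Complex.I * t) (α s) ≠ 0 := fun s => mul_ne_zero_iff.1 (hinv s).1
  exact ⟨hne, MonopoleCurve.adjugate_transpose_col_Psi (MonopoleCurve.I_mul_im_pos ht) z ζ α hne
    fun s => (hinv s).2⟩
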